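/- A (real-time, complete) deterministic visibly push-down automaton (DVPDA) is a tuple $M=(Q,\Sigma,\Gamma,\delta,\bot)$ with a finite set $Q$ of states, a finite input alphabet partitioned as $\Sigma=\Sigma_{\text{call}}\cup\Sigma_{\text{int}}\cup\Sigma_{\text{ret}}$, a finite stack alphabet $\Gamma\ni\bot$, and a transition function consisting of three maps $\delta_c\colon Q\times\Sigma_{\text{call}}\to Q\times(\Gamma\setminus\{\bot\})$, $\delta_i\colon Q\times\Sigma_{\text{int}}\to Q$ and $\delta_r\colon Q\times\Sigma_{\text{ret}}\times\Gamma\to Q$. In state $q$, a call letter $a$ with $\delta_c(q,a)=(q',\gamma)$ changes the state to $q'$ and pushes $\gamma$ on the stack; an internal letter $b$ changes the state to $\delta_i(q,b)$ and leaves the stack unchanged; a return letter $d$ changes the state to $\delta_r(q,d,\gamma)$, where $\gamma$ is the top of the stack, and pops $\gamma$ if $\gamma\neq\bot$, whereas $\bot$ is only read and stays on the stack. A DVPDA is a deterministic very visibly push-down automaton (DVVPDA) if for every $a\in\Sigma_{\text{call}}$ the symbol pushed by $\delta_c(q,a)$ is the same for all $q\in Q$; it is a deterministic visibly counter automaton (DVCA)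 if $|\Gamma\setminus\{\bot\}|=1$. A word $w\in\Sigma^*$ synchronizes $M$ in the empty stack model if there is a state $\overline q\in Q$ such that for every $q\in Q$ the run of $M$ on $w$ that starts in state $q$ with stack content $\bot$ ends in state $\overline q$ with stack content $\bot$. The problem Sync-DVPDA-Empty asks, for a given DVPDA $M$, whether some word synchronizes $M$ in the empty stack model; the problems Sync-DVCA-Empty and Sync-DVVPDA-Empty are the same question for a given DVCA and a given DVVPDA, respectively. An automaton is given as a bit string by the sizes of $Q$, $\Sigma_{\text{call}}$, $\Sigma_{\text{int}}$, $\Sigma_{\text{ret}}$, $\Gamma\setminus\{\bot\}$ and the tables of $\delta_c$, $\delta_i$, $\delta_r$, with all numbers in unary; each problem is identified with the set of the encodings of its yes-instances. Theorem. The problems Sync-DVPDA-Empty, Sync-DVCA-Empty and Sync-DVVPDA-Empty are decidable in polynomial time, i.e. for each of them there is a Turing machine that decides, for every bit string, whether it belongs to the problem, in a number of steps polynomial in the length of the string. -/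

import Mathlib

/-- The letters of a visibly push-down alphabet: the disjoint union of the call letters `C`, the
internal letters `I` and the return letters `R`. -/
inductive VisLetter (C I R : Type) : Type
  | call (a : C) : VisLetter C I R
  | int (b : I) : VisLetter C I R
  | ret (d : R) : VisLetter C I R

/-- A (complete, real-time) deterministic visibly push-down automaton without initial and final
states. `Q` is the set of states, `C`, `I`, `R` are the sets of call, internal and return letters,
and `G` is the stack alphabet without the bottom symbol, so that the full stack alphabet is
`WithBot G`, whose additional element `⊥` is the bottom symbol. -/
structure DVPDA (Q C I R G : Type) : Type where
  /-- on a call letter: the next state, and the symbol other than `⊥` that is pushed -/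
  callTrans : Q → C → Q × G
  /-- on an internal letter: the next state -/
  intTrans : Q → I → Q
  /-- on a return letter and the symbol on top of the stack: the next state -/
  retTrans : Q → R → WithBot G → Q

namespace DVPDA

/-- One step between configurations, that is, pairs of a state and a stack content. The head of the
list is the top of the stack. A return letter pops the top symbol, unless that is the bottom symbol,
which is only read. -/
inductive Step {Q C I R G : Type} (M : DVPDA Q C I R G) :
    Q × List (WithBot G) → VisLetter C I R → Q × List (WithBot G) → Prop
  | call (q : Q) (a : C) (s : List (WithBot G)) :
      Step M (q, s) (VisLetter.call a)
        ((M.callTrans q a).1, ((M.callTrans q a).2 : WithBot G) :: s)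
  | int (q : Q) (b : I) (s : List (WithBot G)) :
      Step M (q, s) (VisLetter.int b) (M.intTrans q b, s)
  | retPop (q : Q) (d : R) (γ : G) (s : List (WithBot G)) :
      Step M (q, (γ : WithBot G) :: s) (VisLetter.ret d) (M.retTrans q d (γ : WithBot G), s)
  | retBot (q : Q) (d : R) (s : List (WithBot G)) :
      Step M (q, ⊥ :: s) (VisLetter.ret d) (M.retTrans q d ⊥, ⊥ :: s)

/-- `M.Run x w y`: reading the word `w` leads from the configuration `x` to the configuration
`y`. -/
inductive Run {Q C I R G : Type} (M : DVPDA Q C I R G) :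
    Q × List (WithBot G) → List (VisLetter C I R) → Q × List (WithBot G) → Prop
  | nil (x : Q × List (WithBot G)) : Run M x [] x
  | cons {x y z : Q × List (WithBot G)} {l : VisLetter C I R} {w : List (VisLetter C I R)} :
      Step M x l y → Run M y w z → Run M x (l :: w) z

/-- `w` is a synchronizing word for `M` in the empty stack model: all runs on `w` that start in
some state with the empty stack (holding `⊥` only) end in one and the same state, again with the
empty stack. -/
def SynchronizesEmpty {Q C I R G : Type} (M : DVPDA Q C I R G) (w : List (VisLetter C I R)) :
    Prop :=
  ∃ r : Q, ∀ q : Q, M.Run (q, [⊥]) w (r, [⊥])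

/-- `M` is a deterministic very visibly push-down automaton: the symbol pushed by a call letter
does not depend on the state. -/
def IsVeryVisibly {Q C I R G : Type} (M : DVPDA Q C I R G) : Prop :=
  ∀ (a : C) (p q : Q), (M.callTrans p a).2 = (M.callTrans q a).2

/-- `M` is a deterministic visibly counter automaton: there is exactly one stack symbol besides the
bottom symbol. -/
def IsCounter {Q C I R G : Type} (_M : DVPDA Q C I R G) : Prop :=
  Nat.card G = 1

end DVPDA

/-- A deterministic visibly push-down automaton as an input of an algorithm: the elements of each
of its five finite sets are numbered. -/
structure DVPDAInstance : Type where
  /-- number of states -/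
  numStates : ℕ
  /-- number of call letters -/
  numCall : ℕ
  /-- number of internal letters -/
  numInt : ℕ
  /-- number of return letters -/
  numRet : ℕ
  /-- number of stack symbols other than `⊥` -/
  numStack : ℕ
  /-- the automaton -/
  aut : DVPDA (Fin numStates) (Fin numCall) (Fin numInt) (Fin numRet) (Fin numStack)

/-- A list of natural numbers as a bit string: `m` becomes `m` ones followed by a zero. -/
def unaryCode (l : List ℕ) : List Bool :=
  l.flatMap fun m => List.replicate m true ++ [false]

namespace DVPDAInstance

/-- The table of the call transitions. -/
def callTable (A : DVPDAInstance) : List ℕ :=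
  (List.finRange A.numStates).flatMap fun q => (List.finRange A.numCall).flatMap fun a =>
    [((A.aut.callTrans q a).1 : ℕ), ((A.aut.callTrans q a).2 : ℕ)]

/-- The table of the internal transitions. -/
def intTable (A : DVPDAInstance) : List ℕ :=
  (List.finRange A.numStates).flatMap fun q => (List.finRange A.numInt).map fun b =>
    (A.aut.intTrans q b : ℕ)

/-- The table of the return transitions. -/
def retTable (A : DVPDAInstance) : List ℕ :=
  (List.finRange A.numStates).flatMap fun q => (List.finRange A.numRet).flatMap fun d =>
    (A.aut.retTrans q d ⊥ : ℕ) ::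
      (List.finRange A.numStack).map fun (γ : Fin A.numStack) =>
        (A.aut.retTrans q d (γ : WithBot (Fin A.numStack)) : ℕ)

/-- The encoding of an automaton as a bit string: the sizes of its five sets, followed by its three
transition tables. All numbers are in unary, which keeps the length polynomial in the number of
states, letters and stack symbols. -/
def encode (A : DVPDAInstance) : List Bool :=
  unaryCode ([A.numStates, A.numCall, A.numInt, A.numRet, A.numStack] ++
    A.callTable ++ A.intTable ++ A.retTable)

end DVPDAInstance

theorem unaryCode_injective : Function.Injective unaryCode := by
  have key : ∀ (m n : ℕ) (u v : List Bool),
      List.replicate m true ++ false :: u = List.replicate n true ++ false :: v →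
        m = n ∧ u = v := by
    intro m
    induction m with
    | zero =>
      intro n u v h
      cases n with
      | zero => simpa using h
      | succ n => simp [List.replicate_succ] at h
    | succ m ih =>
      intro n u v h
      cases n with
      | zero => simp [List.replicate_succ] at h
      | succ n =>
        simp only [List.replicate_succ, List.cons_append, List.cons.injEq, true_and] at h
        obtain ⟨h1, h2⟩ := ih n u v h
        exact ⟨by rw [h1], h2⟩
  intro l
  induction l with
  | nil =>
    intro l' h
    cases l' with
    | nil => rfl
    | cons n l' => simp [unaryCode] at h
  | cons m l ih =>
    intro l' h
    cases l' with
    | nil => simp [unaryCode] at h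
    | cons n l' =>
      have h' : List.replicate m true ++ false :: unaryCode l
          = List.replicate n true ++ false :: unaryCode l' := by
        simpa [unaryCode] using h
      obtain ⟨h1, h2⟩ := key _ _ _ _ h'
      rw [h1, ih h2]

theorem eq_of_flatMap_eq {α β : Type} (f g : α → List β) (hlen : ∀ a, (f a).length = (g a).length)
    (l : List α) (h : l.flatMap f = l.flatMap g) : ∀ a ∈ l, f a = g a := by
  induction l with
  | nil => simp
  | cons b l ih =>
    simp only [List.flatMap_cons] at h
    obtain ⟨h1, h2⟩ := List.append_inj h (hlen b)
    intro a ha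
    rcases List.mem_cons.1 ha with rfl | ha
    · exact h1
    · exact ih h2 a ha

/-- Different automata have different encodings. -/
theorem DVPDAInstance.encode_injective : Function.Injective DVPDAInstance.encode := by
  rintro ⟨n, c, i, r, g, M⟩ ⟨n', c', i', r', g', M'⟩ h
  have h0 := unaryCode_injective h
  simp only [List.cons_append, List.nil_append, List.cons.injEq, List.append_assoc] at h0
  obtain ⟨rfl, rfl, rfl, rfl, rfl, h1⟩ := h0
  obtain ⟨hc, h2⟩ := List.append_inj h1 (by simp [DVPDAInstance.callTable, List.length_flatMap])
  obtain ⟨hi, hr⟩ := List.append_inj h2 (by simp [DVPDAInstance.intTable, List.length_flatMap])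
  have e1 : M.callTrans = M'.callTrans := by
    funext q a
    have h3 := eq_of_flatMap_eq _ _ (by simp) _
      (eq_of_flatMap_eq _ _ (by simp [List.length_flatMap]) _ hc q (List.mem_finRange q))
      a (List.mem_finRange a)
    simp only [List.cons.injEq, and_true] at h3
    exact Prod.ext (Fin.ext h3.1) (Fin.ext h3.2)
  have e2 : M.intTrans = M'.intTrans := by
    funext q b
    have h3 := eq_of_flatMap_eq _ _ (by simp) _ hi q (List.mem_finRange q)
    exact Fin.ext (List.map_inj_left.1 h3 b (List.mem_finRange b))
  have e3 : M.retTrans = M'.retTrans := by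
    funext q d γ
    have h3 := eq_of_flatMap_eq _ _ (by simp) _
      (eq_of_flatMap_eq _ _ (by simp [List.length_flatMap]) _ hr q (List.mem_finRange q))
      d (List.mem_finRange d)
    simp only [List.cons.injEq] at h3
    induction γ using WithBot.recBotCoe with
    | bot => exact Fin.ext h3.1
    | coe γ => exact Fin.ext (List.map_inj_left.1 h3.2 γ (List.mem_finRange γ))
  cases M
  cases M'
  simp only at e1 e2 e3
  subst e1 e2 e3
  rfl

/-- The set of all encodings of deterministic visibly push-down automata that have a synchronizing
word in the empty stack model. -/
def SyncDVPDAEmpty : Language Bool :=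
  {x | ∃ A : DVPDAInstance, x = A.encode ∧ ∃ w, A.aut.SynchronizesEmpty w}

/-- The same problem for deterministic visibly counter automata. -/
def SyncDVCAEmpty : Language Bool :=
  {x | ∃ A : DVPDAInstance, x = A.encode ∧ A.aut.IsCounter ∧ ∃ w, A.aut.SynchronizesEmpty w}

/-- The same problem for deterministic very visibly push-down automata. -/
def SyncDVVPDAEmpty : Language Bool :=
  {x | ∃ A : DVPDAInstance, x = A.encode ∧ A.aut.IsVeryVisibly ∧ ∃ w, A.aut.SynchronizesEmpty w}

/-- The class of languages over `{0, 1}` that are decidable in polynomial time: some Turing machine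
(with finitely many stacks as its tapes, all over finite alphabets) halts on every input string,
malformed ones included, within a number of steps that is polynomial in the length of the string,
and outputs whether the string is in the language. -/
def DecidableInPolyTime (L : Language Bool) : Prop :=
  ∃ f : List Bool → Bool, (∀ x, f x = true ↔ x ∈ L) ∧
    ∃ T : Turing.TM2ComputableInPolyTime (id : List Bool → List Bool) Computability.encodeBool f,
      ∀ k, Finite (T.tm.Γ k)

/-!
A word leads every state with the empty stack to one state with the empty stack if and only if
every two states are merged by some word without unmatched call letters: such words act on the
states as maps, these maps form a monoid, and a map with an image of minimal size in a monoid that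
merges all pairs is constant (`DVPDA.exists_synchronizesEmpty_iff`). Which pair of states can be
led to which pair is described by an inductive relation `DVPDA.Joint`. Its rules are those for
well-matched words (internal letters, composition, and a well-matched word between a call letter
and a return letter), and for words that are read with the empty stack also the return letters
that read the bottom symbol. Both runs have the same stack height at all times, so a word is cut
at the same places for both (`DVPDA.jointFrom_of_run`). For `n` states there are `2 * n ^ 4`
facts, hence the relation is the result of a polynomial number of applications of the rules. The
conditions for counter automata and for very visibly push-down automata can be read off from the
input.

The Turing machines come from a small expression language. `Expr` consists of the lower elementary
functions (addition, truncated subtraction, bounded sums) relative to a bit list. Values and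
evaluation times are bounded by polynomials, and `Expr.compile` turns expressions into structured
programs on stacks (`StackProg`), which in turn are simulated step by step by stack machines
(`StackProg.iterate_step_of_exec`). By `Expr.decidableInPolyTime`, a language is decidable in
polynomial time if it is decided by iterating an expression a polynomial number of times, where
each round puts a new truth value in front of the input. This is enough for a fixed point
computation: at time `t` the fact with number `t` modulo the number of facts is checked against
the facts recorded so far, and the recorded facts are closed under the rules when there have been
more rounds through all facts than there are facts (`recorded_closed_and_least`). Bounded sums
express bounded quantifiers, hence the decoding of the input, the rules, and the final test are
all definable (`AutCode.definable_round`).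
-/

/-! ### Structured programs on stacks and their stack machines -/

/-- Structured programs that act on stacks of bits, the stacks being numbered by the natural
numbers. `pop k` does nothing if stack `k` is empty, and so does `move i j`, which moves the top of
stack `i` to stack `j`. `ite k p q` runs `p` if the top of stack `k` is `true` and `q` otherwise.
`loop k p` runs `p` as long as stack `k` is nonempty. -/
inductive StackProg : Type
  | push (k : ℕ) (b : Bool)
  | pop (k : ℕ)
  | move (i j : ℕ)
  | seq (p q : StackProg)
  | ite (k : ℕ) (p q : StackProg)
  | loop (k : ℕ) (p : StackProg)

namespace StackProg

open Turing

/-- The store after moving the top of stack `i` to stack `j`. -/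
def moveTop (s : ℕ → List Bool) (i j : ℕ) : ℕ → List Bool :=
  match s i with
  | [] => s
  | b :: l => Function.update (Function.update s i l) j (b :: Function.update s i l j)

/-- `Exec p s t s'`: the program `p`, started in the store `s`, terminates after `t` steps in the
store `s'`. -/
inductive Exec : StackProg → (ℕ → List Bool) → ℕ → (ℕ → List Bool) → Prop
  | push (k : ℕ) (b : Bool) (s : ℕ → List Bool) :
      Exec (push k b) s 1 (Function.update s k (b :: s k))
  | pop (k : ℕ) (s : ℕ → List Bool) : Exec (pop k) s 1 (Function.update s k (s k).tail)
  | move (i j : ℕ) (s : ℕ → List Bool) : Exec (move i j) s 1 (moveTop s i j)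
  | seq {p q : StackProg} {s s₁ s₂ : ℕ → List Bool} {t₁ t₂ : ℕ} :
      Exec p s t₁ s₁ → Exec q s₁ t₂ s₂ → Exec (seq p q) s (t₁ + t₂) s₂
  | iteTrue {k : ℕ} {p q : StackProg} {s s₁ : ℕ → List Bool} {t : ℕ} :
      (s k).head? = some true → Exec p s t s₁ → Exec (ite k p q) s (1 + t) s₁
  | iteFalse {k : ℕ} {p q : StackProg} {s s₁ : ℕ → List Bool} {t : ℕ} :
      (s k).head? ≠ some true → Exec q s t s₁ → Exec (ite k p q) s (1 + t) s₁
  | loopDone {k : ℕ} {p : StackProg} {s : ℕ → List Bool} : s k = [] → Exec (loop k p) s 1 s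
  | loopStep {k : ℕ} {p : StackProg} {s s₁ s₂ : ℕ → List Bool} {t₁ t₂ : ℕ} :
      s k ≠ [] → Exec p s t₁ s₁ → Exec (loop k p) s₁ t₂ s₂ → Exec (loop k p) s (1 + t₁ + t₂) s₂

/-- A number above all stacks that occur in a program. -/
def width : StackProg → ℕ
  | push k _ => k + 1
  | pop k => k + 1
  | move i j => max (i + 1) (j + 1)
  | seq p q => max p.width q.width
  | ite k p q => max (k + 1) (max p.width q.width)
  | loop k p => max (k + 1) p.width

/-- The control points of a program. -/
def Label : StackProg → Type
  | push _ _ => Unit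
  | pop _ => Unit
  | move _ _ => Unit
  | seq p q => p.Label ⊕ q.Label
  | ite _ p q => Option (p.Label ⊕ q.Label)
  | loop _ p => Option p.Label

/-- The control point at which a program starts. -/
def entry : (p : StackProg) → p.Label
  | push _ _ => ()
  | pop _ => ()
  | move _ _ => ()
  | seq p _ => Sum.inl p.entry
  | ite _ _ _ => (none : Option _)
  | loop _ _ => (none : Option _)

theorem finite_label : (p : StackProg) → Finite p.Label
  | push _ _ => inferInstanceAs (Finite Unit)
  | pop _ => inferInstanceAs (Finite Unit)
  | move _ _ => inferInstanceAs (Finite Unit)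
  | seq p q =>
    have := p.finite_label
    have := q.finite_label
    inferInstanceAs (Finite (p.Label ⊕ q.Label))
  | ite _ p q =>
    have := p.finite_label
    have := q.finite_label
    inferInstanceAs (Finite (Option (p.Label ⊕ q.Label)))
  | loop _ p =>
    have := p.finite_label
    inferInstanceAs (Finite (Option p.Label))

/-- The statement of a stack machine at a control point of a program. The labels of the machine
are given by `emb`, and the machine goes to the label `exit` after the program. The internal state
holds the symbol that was read last, and it is `none` between two steps. -/
def code (D : ℕ) : (p : StackProg) → {L : Type} → (p.Label → L) → L → p.Label →
    TM2.Stmt (fun _ : Fin (D + 1) => Bool) L (Option Bool)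
  | push k b, _, _, exit, _ => .push (Fin.ofNat (D + 1) k) (fun _ => b) (.goto fun _ => exit)
  | pop k, _, _, exit, _ => .pop (Fin.ofNat (D + 1) k) (fun v _ => v) (.goto fun _ => exit)
  | move i j, _, _, exit, _ =>
    .pop (Fin.ofNat (D + 1) i) (fun _ o => o)
      (.branch Option.isSome
        (.push (Fin.ofNat (D + 1) j) (fun v => v.getD false)
          (.load (fun _ => none) (.goto fun _ => exit)))
        (.goto fun _ => exit))
  | seq p q, _, emb, exit, l =>
    match l with
    | Sum.inl l => code D p (fun l => emb (Sum.inl l)) (emb (Sum.inr q.entry)) l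
    | Sum.inr l => code D q (fun l => emb (Sum.inr l)) exit l
  | ite k p q, _, emb, exit, l =>
    match l with
    | none =>
      .peek (Fin.ofNat (D + 1) k) (fun _ o => o)
        (.branch (fun v => v.getD false)
          (.load (fun _ => none) (.goto fun _ => emb (some (Sum.inl p.entry))))
          (.load (fun _ => none) (.goto fun _ => emb (some (Sum.inr q.entry)))))
    | some (Sum.inl l) => code D p (fun l => emb (some (Sum.inl l))) exit l
    | some (Sum.inr l) => code D q (fun l => emb (some (Sum.inr l))) exit l
  | loop k p, _, emb, exit, l =>
    match l with
    | none =>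
      .peek (Fin.ofNat (D + 1) k) (fun _ o => o)
        (.branch Option.isSome
          (.load (fun _ => none) (.goto fun _ => emb (some p.entry)))
          (.goto fun _ => exit))
    | some l => code D p (fun l => emb (some l)) (emb none) l

section Simulation

variable {D : ℕ} {L : Type}

/-- The first `D + 1` stacks of a store. -/
def restrict (D : ℕ) (s : ℕ → List Bool) : Fin (D + 1) → List Bool := fun k => s k

theorem restrict_update {k : ℕ} (hk : k < D + 1) (s : ℕ → List Bool) (l : List Bool) :
    restrict D (Function.update s k l)
      = Function.update (restrict D s) (Fin.ofNat (D + 1) k) l := by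
  funext j
  have : (Fin.ofNat (D + 1) k : Fin (D + 1)) = ⟨k, hk⟩ := by
    ext; simp [Nat.mod_eq_of_lt hk]
  rw [this]
  simp only [restrict, Function.update_apply, Fin.ext_iff]

theorem restrict_apply {k : ℕ} (hk : k < D + 1) (s : ℕ → List Bool) :
    restrict D s (Fin.ofNat (D + 1) k) = s k := by
  simp [restrict, Nat.mod_eq_of_lt hk]

/-- The configuration of the stack machine at label `l` with the store `s`. -/
def conf (D : ℕ) (l : Option L) (s : ℕ → List Bool) :
    TM2.Cfg (fun _ : Fin (D + 1) => Bool) L (Option Bool) :=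
  ⟨l, none, restrict D s⟩

theorem iterate_step_one {m : L → TM2.Stmt (fun _ : Fin (D + 1) => Bool) L (Option Bool)}
    {l : L} {s : ℕ → List Bool} {c : TM2.Cfg (fun _ : Fin (D + 1) => Bool) L (Option Bool)}
    (h : TM2.stepAux (m l) none (restrict D s) = c) :
    (flip bind (TM2.step m))^[1] (some (conf D (some l) s)) = some c :=
  congrArg some h

theorem iterate_add_of_eq {α : Type} {f : α → α} {a b c : α} {t₁ t₂ : ℕ} (h₁ : f^[t₁] a = b)
    (h₂ : f^[t₂] b = c) : f^[t₁ + t₂] a = c := by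
  rw [add_comm t₁ t₂, Function.iterate_add_apply, h₁, h₂]

/-- A stack machine that contains the code of a program executes the program, in the same number
of steps. -/
theorem iterate_step_of_exec (m : L → TM2.Stmt (fun _ : Fin (D + 1) => Bool) L (Option Bool))
    {p : StackProg} {s s' : ℕ → List Bool} {t : ℕ} (h : Exec p s t s') :
    ∀ (emb : p.Label → L) (exit : L), p.width ≤ D + 1 →
      (∀ l, m (emb l) = code D p emb exit l) →
      (flip bind (TM2.step m))^[t] (some (conf D (some (emb p.entry)) s))
        = some (conf D (some exit) s') := by
  induction h with
  | push k b s =>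
    intro emb exit hw hm
    have hk : k < D + 1 := hw
    refine iterate_step_one ?_
    rw [hm]
    simp only [code, TM2.stepAux, conf]
    rw [restrict_update hk, restrict_apply hk]
  | pop k s =>
    intro emb exit hw hm
    have hk : k < D + 1 := hw
    refine iterate_step_one ?_
    rw [hm]
    simp only [code, TM2.stepAux, conf]
    rw [restrict_update hk, restrict_apply hk]
  | move i j s =>
    intro emb exit hw hm
    have hi : i < D + 1 := (le_max_left _ _).trans hw
    have hj : j < D + 1 := (le_max_right _ _).trans hw
    refine iterate_step_one ?_
    rw [hm]
    simp only [code, TM2.stepAux, restrict_apply hi, moveTop, conf]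
    rcases hs : s i with _ | ⟨b, l⟩
    · simp only [List.head?_nil, Option.isSome_none, cond_false, List.tail_nil]
      rw [← restrict_update hi, ← hs, Function.update_eq_self]
    · simp only [List.head?_cons, Option.isSome_some, cond_true, List.tail_cons, Option.getD_some]
      rw [← restrict_update hi, restrict_apply hj, ← restrict_update hj]
  | @seq p q s s₁ s₂ t₁ t₂ _ _ ih₁ ih₂ =>
    intro emb exit hw hm
    have h₁ := ih₁ (fun l => emb (Sum.inl l)) (emb (Sum.inr q.entry))
      ((le_max_left _ _).trans hw) (fun l => hm (Sum.inl l))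
    have h₂ := ih₂ (fun l => emb (Sum.inr l)) exit
      ((le_max_right _ _).trans hw) (fun l => hm (Sum.inr l))
    exact iterate_add_of_eq h₁ h₂
  | @iteTrue k p q s s₁ t hk _ ih =>
    intro emb exit hw hm
    have hk' : k < D + 1 := (le_max_left _ _).trans hw
    have h₁ := ih (fun l => emb (some (Sum.inl l))) exit
      (((le_max_left _ _).trans (le_max_right _ _)).trans hw) (fun l => hm (some (Sum.inl l)))
    refine iterate_add_of_eq (iterate_step_one ?_) h₁
    rw [hm]
    simp only [code, entry, TM2.stepAux, conf, restrict_apply hk', hk, Option.getD_some, cond_true]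
  | @iteFalse k p q s s₁ t hk _ ih =>
    intro emb exit hw hm
    have hk' : k < D + 1 := (le_max_left _ _).trans hw
    have h₁ := ih (fun l => emb (some (Sum.inr l))) exit
      (((le_max_right _ _).trans (le_max_right _ _)).trans hw) (fun l => hm (some (Sum.inr l)))
    refine iterate_add_of_eq (iterate_step_one ?_) h₁
    have hg : (s k).head?.getD false = false := by
      rcases h : (s k).head? with _ | _ | _ <;> simp_all
    rw [hm]
    simp only [code, entry, TM2.stepAux, conf, restrict_apply hk', hg, cond_false]
  | @loopDone k p s hk =>
    intro emb exit hw hm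
    have hk' : k < D + 1 := (le_max_left _ _).trans hw
    refine iterate_step_one ?_
    rw [hm]
    simp only [code, entry, TM2.stepAux, conf, restrict_apply hk', hk, List.head?_nil,
      Option.isSome_none, cond_false]
  | @loopStep k p s s₁ s₂ t₁ t₂ hk _ _ ih₁ ih₂ =>
    intro emb exit hw hm
    have hk' : k < D + 1 := (le_max_left _ _).trans hw
    have h₁ := ih₁ (fun l => emb (some l)) (emb none)
      ((le_max_right _ _).trans hw) (fun l => hm (some l))
    have h₂ := ih₂ emb exit hw hm
    refine iterate_add_of_eq (iterate_add_of_eq (iterate_step_one ?_) h₁) h₂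
    obtain ⟨b, l, hs⟩ := List.exists_cons_of_ne_nil hk
    rw [hm]
    simp only [code, entry, TM2.stepAux, conf, restrict_apply hk', hs, List.head?_cons,
      Option.isSome_some, cond_true]

end Simulation

/-- The stack machine of a program: the input is on stack `0` and the output on stack `1`. -/
noncomputable def machine (p : StackProg) : FinTM2 :=
  letI := p.finite_label
  letI : Fintype p.Label := Fintype.ofFinite _
  { K := Fin (p.width + 1 + 1)
    k₀ := ⟨0, by omega⟩
    k₁ := ⟨1, by omega⟩
    Γ := fun _ => Bool
    Λ := Option p.Label
    main := some p.entry
    σ := Option Bool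
    initialState := none
    m := fun l => match l with
      | none => .halt
      | some l => code (p.width + 1) p some none l }

/-- A program that decides membership in a language in polynomial time gives a Turing machine that
does. -/
theorem decidableInPolyTime (p : StackProg) (P : Polynomial ℕ) {X : Language Bool}
    (f : List Bool → Bool) (hf : ∀ x, f x = true ↔ x ∈ X)
    (h : ∀ x : List Bool, ∃ t ≤ P.eval x.length,
      Exec p (Function.update (fun _ => []) 0 x) t (Function.update (fun _ => []) 1 [f x])) :
    DecidableInPolyTime X := by
  refine ⟨f, hf, ⟨⟨⟨machine p, Equiv.refl Bool, Equiv.refl Bool⟩, P + 1, fun x => ?_⟩,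
    fun k => Finite.of_fintype Bool⟩⟩
  refine Classical.choice ?_
  obtain ⟨t, ht, he⟩ := h x
  refine ⟨⟨⟨t + 1, ?_⟩, by simpa using ht⟩⟩
  have h₁ := iterate_step_of_exec (machine p).m he (fun l => some l) none (by omega)
    (fun l => rfl)
  have hinit : initList (machine p) (List.map (Equiv.refl Bool).invFun (id x))
      = conf (p.width + 1) (some (some p.entry)) (Function.update (fun _ => []) 0 x) := by
    refine congrArg (TM2.Cfg.mk _ _) (funext fun k => ?_)
    by_cases hk : k = (machine p).k₀
    · subst hk
      rw [dif_pos rfl]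
      exact List.map_id _
    · rw [dif_neg hk]
      have hk' : Fin.val (n := p.width + 1 + 1) k ≠ 0 := fun h => hk (Fin.ext h)
      exact (Function.update_of_ne hk' x (fun _ => ([] : List Bool))).symm
  have hfin : haltList (machine p)
      (List.map (Equiv.refl Bool).invFun (Computability.encodeBool (f x)))
      = conf (p.width + 1) none (Function.update (fun _ => []) 1 [f x]) := by
    refine congrArg (TM2.Cfg.mk _ _) (funext fun k => ?_)
    by_cases hk : k = (machine p).k₁
    · subst hk
      rw [dif_pos rfl]
      rfl
    · rw [dif_neg hk]
      have hk' : Fin.val (n := p.width + 1 + 1) k ≠ 1 := fun h => hk (Fin.ext h)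
      exact (Function.update_of_ne hk' [f x] (fun _ => ([] : List Bool))).symm
  rw [hinit]
  simp only [Option.map_some]
  rw [hfin]
  exact iterate_add_of_eq h₁ rfl

end StackProg

/-! ### Expressions over a bit list -/

/-- Expressions for number-valued functions of a bit list and of numerical variables (de Bruijn
indices): `len` is the length of the list, `read e` is `1` if the entry of the list at position `e`
is `true` and `0` otherwise, `sub` is truncated subtraction, and `sum e f` is the sum of `f` over
all values below `e` of a new variable. These are the lower elementary functions relative to the
list. -/
inductive Expr : Type
  | var (i : ℕ)
  | one
  | len
  | add (a b : Expr)
  | sub (a b : Expr)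
  | sum (a f : Expr)
  | read (a : Expr)

namespace Expr

/-- The assignment with the new value `i` for variable `0` and the old values moved up. -/
def scons (i : ℕ) (v : ℕ → ℕ) : ℕ → ℕ
  | 0 => i
  | n + 1 => v n

/-- The value of an expression. -/
def eval (A : List Bool) : Expr → (ℕ → ℕ) → ℕ
  | var i, v => v i
  | one, _ => 1
  | len, _ => A.length
  | add a b, v => a.eval A v + b.eval A v
  | sub a b, v => a.eval A v - b.eval A v
  | sum a f, v => ∑ i ∈ Finset.range (a.eval A v), f.eval A (scons i v)
  | read a, v => if A[a.eval A v]? = some true then 1 else 0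

open Polynomial in
/-- A polynomial bound on the value of an expression in terms of a bound on the length of the list
and on the variables. -/
noncomputable def valueBound : Expr → Polynomial ℕ
  | var _ => X
  | one => 1
  | len => X
  | add a b => a.valueBound + b.valueBound
  | sub a _ => a.valueBound
  | sum a f => a.valueBound * f.valueBound.comp (X + a.valueBound)
  | read _ => 1

theorem eval_le_valueBound (A : List Bool) (e : Expr) : ∀ {m : ℕ} {v : ℕ → ℕ}, A.length ≤ m →
    (∀ i, v i ≤ m) → e.eval A v ≤ e.valueBound.eval m := by
  induction e with
  | var i => intro m v hA hv; simpa [eval, valueBound] using hv i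
  | one => intro m v hA hv; simp [eval, valueBound]
  | len => intro m v hA hv; simpa [eval, valueBound] using hA
  | add a b iha ihb =>
    intro m v hA hv
    simpa [eval, valueBound] using add_le_add (iha hA hv) (ihb hA hv)
  | sub a b iha ihb =>
    intro m v hA hv
    exact (Nat.sub_le _ _).trans (iha hA hv)
  | sum a f iha ihf =>
    intro m v hA hv
    simp only [eval, valueBound, Polynomial.eval_mul, Polynomial.eval_comp, Polynomial.eval_add,
      Polynomial.eval_X]
    refine (Finset.sum_le_card_nsmul _ _ (f.valueBound.eval (m + a.valueBound.eval m))
      fun i hi => ?_).trans ?_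
    · refine ihf (by omega) fun j => ?_
      have := iha hA hv
      have hi' := Finset.mem_range.1 hi
      cases j with
      | zero => simp only [scons]; omega
      | succ j => exact (hv j).trans (by omega)
    · rw [Finset.card_range, smul_eq_mul]
      exact Nat.mul_le_mul_right _ (iha hA hv)
  | read a iha => intro m v hA hv; simp only [eval, valueBound, Polynomial.eval_one]; split <;> simp

end Expr

/-! ### Running times of basic programs on registers -/

namespace StackProg

/-- `Runs p s T s'`: the program `p` leads from the store `s` to the store `s'` in at most `T`
steps. -/
def Runs (p : StackProg) (s : ℕ → List Bool) (T : ℕ) (s' : ℕ → List Bool) : Prop :=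
  ∃ t ≤ T, Exec p s t s'

theorem Runs.mono {p : StackProg} {s s' : ℕ → List Bool} {T T' : ℕ} (h : Runs p s T s')
    (hT : T ≤ T') : Runs p s T' s' := by
  obtain ⟨t, ht, h⟩ := h
  exact ⟨t, ht.trans hT, h⟩

theorem Runs.seq {p q : StackProg} {s s₁ s₂ : ℕ → List Bool} {T₁ T₂ : ℕ} (h₁ : Runs p s T₁ s₁)
    (h₂ : Runs q s₁ T₂ s₂) : Runs (seq p q) s (T₁ + T₂) s₂ := by
  obtain ⟨t₁, ht₁, h₁⟩ := h₁
  obtain ⟨t₂, ht₂, h₂⟩ := h₂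
  exact ⟨t₁ + t₂, by omega, h₁.seq h₂⟩

theorem Runs.loop {key : ℕ} {p : StackProg} (S : ℕ → ℕ → List Bool) (T n : ℕ)
    (h₀ : S 0 key = []) (hne : ∀ k < n, S (k + 1) key ≠ [])
    (hs : ∀ k < n, Runs p (S (k + 1)) T (S k)) :
    Runs (loop key p) (S n) (n * (T + 1) + 1) (S 0) := by
  induction n with
  | zero => exact ⟨1, by omega, Exec.loopDone h₀⟩
  | succ n ih =>
    obtain ⟨t₂, ht₂, h₂⟩ := ih (fun k hk => hne k (by omega)) (fun k hk => hs k (by omega))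
    obtain ⟨t₁, ht₁, h₁⟩ := hs n (by omega)
    refine ⟨1 + t₁ + t₂, ?_, Exec.loopStep (hne n (by omega)) h₁ h₂⟩
    rw [Nat.succ_mul]
    omega

/-- The store with the list `A` on stack `0`, the list `B` on stack `1`, and the number `R j` in
unary on stack `j + 2`, which serves as register `j`. -/
def store (A B : List Bool) (R : ℕ → ℕ) : ℕ → List Bool
  | 0 => A
  | 1 => B
  | j + 2 => List.replicate (R j) true

theorem update_store_zero (A A' B : List Bool) (R : ℕ → ℕ) :
    Function.update (store A B R) 0 A' = store A' B R := by
  funext k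
  match k with
  | 0 => rfl
  | 1 => rfl
  | j + 2 => rfl

theorem update_store_one (A B B' : List Bool) (R : ℕ → ℕ) :
    Function.update (store A B R) 1 B' = store A B' R := by
  funext k
  match k with
  | 0 => rfl
  | 1 => rfl
  | j + 2 => rfl

theorem update_store_add_two (A B : List Bool) (R : ℕ → ℕ) (j m : ℕ) :
    Function.update (store A B R) (j + 2) (List.replicate m true)
      = store A B (Function.update R j m) := by
  funext k
  match k with
  | 0 => rfl
  | 1 => rfl
  | i + 2 =>
    by_cases h : i = j
    · subst h; simp [store]
    · simp [store, Function.update_of_ne h, Function.update_of_ne (show i + 2 ≠ j + 2 by omega)]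

theorem runs_push_reg (A B : List Bool) (R : ℕ → ℕ) (j : ℕ) :
    Runs (push (j + 2) true) (store A B R) 1 (store A B (Function.update R j (R j + 1))) := by
  rw [← update_store_add_two]
  exact ⟨1, le_rfl, Exec.push _ _ _⟩

theorem runs_push_zero (A B : List Bool) (R : ℕ → ℕ) (b : Bool) :
    Runs (push 0 b) (store A B R) 1 (store (b :: A) B R) := by
  rw [← update_store_zero A (b :: A)]
  exact ⟨1, le_rfl, Exec.push _ _ _⟩

theorem runs_push_one (A B : List Bool) (R : ℕ → ℕ) (b : Bool) :
    Runs (push 1 b) (store A B R) 1 (store A (b :: B) R) := by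
  rw [← update_store_one A B (b :: B)]
  exact ⟨1, le_rfl, Exec.push _ _ _⟩

theorem runs_pop_zero (A B : List Bool) (R : ℕ → ℕ) :
    Runs (pop 0) (store A B R) 1 (store A.tail B R) := by
  rw [← update_store_zero A A.tail]
  exact ⟨1, le_rfl, Exec.pop _ _⟩

theorem runs_pop_reg (A B : List Bool) (R : ℕ → ℕ) (j : ℕ) :
    Runs (pop (j + 2)) (store A B R) 1 (store A B (Function.update R j (R j - 1))) := by
  rw [← update_store_add_two, ← List.tail_replicate]
  exact ⟨1, le_rfl, Exec.pop _ _⟩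

theorem runs_move_zero_one (A B : List Bool) (b : Bool) (R : ℕ → ℕ) :
    Runs (move 0 1) (store (b :: A) B R) 1 (store A (b :: B) R) := by
  have h := Exec.move 0 1 (store (b :: A) B R)
  have e : moveTop (store (b :: A) B R) 0 1 = store A (b :: B) R := by
    simp only [moveTop, store]
    rw [update_store_zero, update_store_one]
    rfl
  exact ⟨1, le_rfl, e ▸ h⟩

theorem runs_move_zero_one_nil (B : List Bool) (R : ℕ → ℕ) :
    Runs (move 0 1) (store [] B R) 1 (store [] B R) :=
  ⟨1, le_rfl, Exec.move 0 1 (store [] B R)⟩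

theorem runs_move_one_zero (A B : List Bool) (b : Bool) (R : ℕ → ℕ) :
    Runs (move 1 0) (store A (b :: B) R) 1 (store (b :: A) B R) := by
  have h := Exec.move 1 0 (store A (b :: B) R)
  have e : moveTop (store A (b :: B) R) 1 0 = store (b :: A) B R := by
    simp only [moveTop, store]
    rw [update_store_one, update_store_zero]
    rfl
  exact ⟨1, le_rfl, e ▸ h⟩

theorem runs_move_reg_one (A B : List Bool) (R : ℕ → ℕ) (j m : ℕ) (hj : R j = m + 1) :
    Runs (move (j + 2) 1) (store A B R) 1 (store A (true :: B) (Function.update R j m)) := by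
  have h := Exec.move (j + 2) 1 (store A B R)
  have e : moveTop (store A B R) (j + 2) 1 = store A (true :: B) (Function.update R j m) := by
    simp only [moveTop, store, hj, List.replicate_succ]
    rw [update_store_add_two, update_store_one]
    rfl
  exact ⟨1, le_rfl, e ▸ h⟩

theorem runs_move_one_reg (A B : List Bool) (R : ℕ → ℕ) (j : ℕ) :
    Runs (move 1 (j + 2)) (store A (true :: B) R) 1
      (store A B (Function.update R j (R j + 1))) := by
  have h := Exec.move 1 (j + 2) (store A (true :: B) R)
  have e : moveTop (store A (true :: B) R) 1 (j + 2)
      = store A B (Function.update R j (R j + 1)) := by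
    simp only [moveTop, store]
    rw [update_store_one, ← update_store_add_two]
    rfl
  exact ⟨1, le_rfl, e ▸ h⟩

theorem runs_move_reg_reg (A B : List Bool) (R : ℕ → ℕ) {i j : ℕ} (m : ℕ) (hij : i ≠ j)
    (hi : R i = m + 1) :
    Runs (move (i + 2) (j + 2)) (store A B R) 1
      (store A B (Function.update (Function.update R i m) j (R j + 1))) := by
  have h := Exec.move (i + 2) (j + 2) (store A B R)
  have e : moveTop (store A B R) (i + 2) (j + 2)
      = store A B (Function.update (Function.update R i m) j (R j + 1)) := by
    simp only [moveTop, store, hi, List.replicate_succ]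
    rw [update_store_add_two, ← update_store_add_two _ _ (Function.update R i m)]
    simp only [store, Function.update_of_ne hij.symm, List.replicate_succ]
  exact ⟨1, le_rfl, e ▸ h⟩

/-- Register `j` is set to zero. -/
theorem runs_clear_reg (A B : List Bool) (R : ℕ → ℕ) (j : ℕ) :
    Runs (loop (j + 2) (pop (j + 2))) (store A B R) (R j * 2 + 1)
      (store A B (Function.update R j 0)) := by
  have h := Runs.loop (key := j + 2) (p := pop (j + 2))
    (fun k => store A B (Function.update R j k)) 1 (R j) (by simp [store]) (by simp [store])
    (fun k _ => by simpa using runs_pop_reg A B (Function.update R j (k + 1)) j)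
  simpa using h

/-- Register `i` is added to register `j` and set to zero. -/
theorem runs_transfer (A B : List Bool) (R : ℕ → ℕ) {i j : ℕ} (hij : i ≠ j) :
    Runs (loop (i + 2) (move (i + 2) (j + 2))) (store A B R) (R i * 2 + 1)
      (store A B (Function.update (Function.update R i 0) j (R j + R i))) := by
  have h := Runs.loop (key := i + 2) (p := move (i + 2) (j + 2))
    (fun k => store A B (Function.update (Function.update R i k) j (R j + (R i - k)))) 1 (R i)
    (by simp [store, Function.update_of_ne hij]) (by simp [store, Function.update_of_ne hij])
    (fun k hk => by
      have h := runs_move_reg_reg A B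
        (Function.update (Function.update R i (k + 1)) j (R j + (R i - (k + 1)))) k hij
        (by simp [Function.update_of_ne hij])
      convert h using 2
      funext l
      by_cases h₁ : l = j
      · subst h₁; simp; omega
      · by_cases h₂ : l = i
        · subst h₂; simp [h₁]
        · simp [h₁, h₂])
  simpa using h

/-- Register `i` is copied to the empty register `j`. -/
def copyReg (i j : ℕ) : StackProg :=
  seq (loop (i + 2) (move (i + 2) 1)) (loop 1 (seq (push (j + 2) true) (move 1 (i + 2))))

theorem runs_copyReg (A : List Bool) (R : ℕ → ℕ) {i j : ℕ} (hij : i ≠ j) (hj : R j = 0) :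
    Runs (copyReg i j) (store A [] R) (R i * 5 + 2)
      (store A [] (Function.update R j (R i))) := by
  have h₁ := Runs.loop (key := i + 2) (p := move (i + 2) 1)
    (fun k => store A (List.replicate (R i - k) true) (Function.update R i k)) 1 (R i)
    (by simp [store]) (by simp [store])
    (fun k hk => by
      have h := runs_move_reg_one A (List.replicate (R i - (k + 1)) true)
        (Function.update R i (k + 1)) i k (by simp)
      convert h using 2
      · rw [← List.replicate_succ]; congr 1; omega
      · simp)
  have h₂ := Runs.loop (key := 1) (p := seq (push (j + 2) true) (move 1 (i + 2)))
    (fun k => store A (List.replicate k true)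
      (Function.update (Function.update R i (R i - k)) j (R i - k))) 2 (R i)
    (by simp [store]) (by simp [store])
    (fun k hk => by
      refine ((runs_push_reg _ _ _ j).seq (T₂ := 1) ?_).mono le_rfl
      have h := runs_move_one_reg A (List.replicate k true)
        (Function.update (Function.update R i (R i - (k + 1))) j (R i - (k + 1) + 1)) i
      simp only [Function.update_self, Function.update_idem, List.replicate_succ]
      convert h using 2
      funext l
      by_cases e₁ : l = j
      · subst e₁; simp [Function.update_of_ne hij.symm]; omega
      · by_cases e₂ : l = i
        · subst e₂; simp only [Function.update_of_ne e₁, Function.update_self]; omega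
        · simp [e₁, e₂])
  simp only [Nat.sub_self, List.replicate_zero, Function.update_eq_self, Nat.sub_zero] at h₁ h₂
  have hz : Function.update (Function.update R i 0) j 0 = Function.update R i 0 := by
    funext l
    by_cases h₁ : l = j
    · subst h₁; simp [Function.update_of_ne hij.symm, hj]
    · simp [h₁]
  rw [hz] at h₂
  exact (h₁.seq h₂).mono (by omega)

end StackProg

namespace StackProg

/-- The length of the list on stack `0` is stored in the empty register `d`. -/
def lengthReg (d : ℕ) : StackProg :=
  seq (loop 0 (seq (move 0 1) (push (d + 2) true))) (loop 1 (move 1 0))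

theorem runs_restore (A B : List Bool) (R : ℕ → ℕ) :
    Runs (loop 1 (move 1 0)) (store A B R) (B.length * 2 + 1) (store (B.reverse ++ A) [] R) := by
  induction B generalizing A with
  | nil => exact ⟨1, by simp, Exec.loopDone rfl⟩
  | cons b B ih =>
    obtain ⟨t₁, ht₁, h₁⟩ := runs_move_one_zero A B b R
    obtain ⟨t₂, ht₂, h₂⟩ := ih (b :: A)
    refine ⟨1 + t₁ + t₂, by simp only [List.length_cons]; omega, ?_⟩
    simpa using Exec.loopStep (by simp [store]) h₁ h₂

theorem runs_lengthReg (A : List Bool) (R : ℕ → ℕ) (d : ℕ) (hd : R d = 0) :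
    Runs (lengthReg d) (store A [] R) (A.length * 5 + 2)
      (store A [] (Function.update R d A.length)) := by
  have h : ∀ (A B : List Bool) (R : ℕ → ℕ),
      Runs (loop 0 (seq (move 0 1) (push (d + 2) true))) (store A B R) (A.length * 3 + 1)
        (store [] (A.reverse ++ B) (Function.update R d (R d + A.length))) := by
    intro A
    induction A with
    | nil => intro B R; exact ⟨1, by simp, by simpa using Exec.loopDone rfl⟩
    | cons b A ih =>
      intro B R
      obtain ⟨t₁, ht₁, h₁⟩ := (runs_move_zero_one A B b R).seq (runs_push_reg A (b :: B) R d)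
      obtain ⟨t₂, ht₂, h₂⟩ := ih (b :: B) (Function.update R d (R d + 1))
      refine ⟨1 + t₁ + t₂, by simp only [List.length_cons]; omega, ?_⟩
      have := Exec.loopStep (by simp [store]) h₁ h₂
      simpa [add_assoc, add_comm 1] using this
  have h₁ := (h A [] R).seq (runs_restore _ _ _)
  simp only [List.append_nil, List.reverse_reverse, List.length_reverse, hd, Nat.zero_add] at h₁
  exact h₁.mono (by omega)

/-- The number in register `d` is replaced by `1` if the entry of the list on stack `0` at that
position is `true`, and by `0` otherwise. In the second case `pop` is applied to an empty stack and
has no effect. -/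
def readReg (d : ℕ) : StackProg :=
  seq (loop (d + 2) (seq (pop (d + 2)) (move 0 1)))
    (seq (ite 0 (push (d + 2) true) (pop (d + 2))) (loop 1 (move 1 0)))

theorem runs_readReg (A : List Bool) (R : ℕ → ℕ) (d : ℕ) :
    Runs (readReg d) (store A [] R) (R d * 3 + A.length * 2 + 4)
      (store A [] (Function.update R d (if A[R d]? = some true then 1 else 0))) := by
  have h₁ : ∀ (n : ℕ) (A B : List Bool),
      Runs (loop (d + 2) (seq (pop (d + 2)) (move 0 1))) (store A B (Function.update R d n))
        (n * 3 + 1) (store (A.drop n) ((A.take n).reverse ++ B) (Function.update R d 0)) := by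
    intro n
    induction n with
    | zero => intro A B; exact ⟨1, by simp, by simpa using Exec.loopDone (by simp [store])⟩
    | succ n ih =>
      intro A B
      have hp : Runs (pop (d + 2)) (store A B (Function.update R d (n + 1))) 1
          (store A B (Function.update R d n)) := by
        simpa using runs_pop_reg A B (Function.update R d (n + 1)) d
      cases A with
      | nil =>
        obtain ⟨t₁, ht₁, h₁⟩ := hp.seq (runs_move_zero_one_nil B _)
        obtain ⟨t₂, ht₂, h₂⟩ := ih [] B
        refine ⟨1 + t₁ + t₂, by omega, ?_⟩
        simpa using Exec.loopStep (by simp [store]) h₁ h₂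
      | cons b A =>
        obtain ⟨t₁, ht₁, h₁⟩ := hp.seq (runs_move_zero_one A B b _)
        obtain ⟨t₂, ht₂, h₂⟩ := ih A (b :: B)
        refine ⟨1 + t₁ + t₂, by omega, ?_⟩
        simpa using Exec.loopStep (by simp [store]) h₁ h₂
  have h₂ : Runs (ite 0 (push (d + 2) true) (pop (d + 2)))
      (store (A.drop (R d)) (A.take (R d)).reverse (Function.update R d 0)) 2
      (store (A.drop (R d)) (A.take (R d)).reverse
        (Function.update R d (if A[R d]? = some true then 1 else 0))) := by
    have hh : (A.drop (R d)).head? = A[R d]? := by simp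
    by_cases h : A[R d]? = some true
    · obtain ⟨t, ht, h'⟩ := runs_push_reg (A.drop (R d)) (A.take (R d)).reverse
        (Function.update R d 0) d
      refine ⟨1 + t, by omega, Exec.iteTrue (by simp only [store]; rw [hh, h]) ?_⟩
      simpa [h] using h'
    · obtain ⟨t, ht, h'⟩ := runs_pop_reg (A.drop (R d)) (A.take (R d)).reverse
        (Function.update R d 0) d
      refine ⟨1 + t, by omega, Exec.iteFalse (by simp only [store]; rw [hh]; exact h) ?_⟩
      simpa [h] using h'
  have h₁ := h₁ (R d) A []
  rw [List.append_nil] at h₁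
  have h := h₁.seq (h₂.seq (runs_restore _ _ _))
  simp only [Function.update_eq_self, List.reverse_reverse, List.take_append_drop,
    List.length_reverse, List.length_take] at h
  refine h.mono ?_
  omega

end StackProg

/-! ### Evaluation of expressions by programs -/

namespace Expr

open StackProg

/-- A program that computes the value of an expression in register `d`. Variable `i` is in register
`ρ i`, and the registers from `d` on are empty at the beginning. For a sum, register `d` accumulates
the result, register `d + 1` holds the new variable, and register `d + 2` counts the remaining
summands. -/
def compile : Expr → (ℕ → ℕ) → ℕ → StackProg
  | var i, ρ, d => copyReg (ρ i) d
  | one, _, d => push (d + 2) true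
  | len, _, d => lengthReg d
  | add a b, ρ, d =>
    seq (compile a ρ d)
      (seq (compile b ρ (d + 1)) (loop (d + 1 + 2) (move (d + 1 + 2) (d + 2))))
  | sub a b, ρ, d =>
    seq (compile a ρ d)
      (seq (compile b ρ (d + 1)) (loop (d + 1 + 2) (seq (pop (d + 1 + 2)) (pop (d + 2)))))
  | sum a f, ρ, d =>
    seq (compile a ρ (d + 2))
      (seq
        (loop (d + 2 + 2)
          (seq (pop (d + 2 + 2))
            (seq (compile f (scons (d + 1) ρ) (d + 3))
              (seq (loop (d + 3 + 2) (move (d + 3 + 2) (d + 2))) (push (d + 1 + 2) true)))))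
        (loop (d + 1 + 2) (pop (d + 1 + 2))))
  | read a, ρ, d => seq (compile a ρ d) (readReg d)

open Polynomial in
/-- A polynomial bound on the time for the evaluation of an expression, in terms of a bound on the
length of the list and on the variables. -/
noncomputable def timeBound : Expr → Polynomial ℕ
  | var _ => X * 5 + 2
  | one => 1
  | len => X * 5 + 2
  | add a b => a.timeBound + b.timeBound + b.valueBound * 2 + 1
  | sub a b => a.timeBound + b.timeBound + b.valueBound * 3 + 1
  | sum a f =>
    a.timeBound + a.valueBound * (f.timeBound.comp (X + a.valueBound)
      + f.valueBound.comp (X + a.valueBound) * 2 + 4) + a.valueBound * 2 + 2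
  | read a => a.timeBound + a.valueBound * 3 + X * 2 + 4

/-- The compiled program computes the value of the expression in polynomial time and leaves all
other registers and the list unchanged. -/
theorem runs_compile (A : List Bool) (e : Expr) : ∀ (ρ : ℕ → ℕ) (d : ℕ) (R : ℕ → ℕ) (m : ℕ),
    (∀ i, ρ i < d) → (∀ j, d ≤ j → R j = 0) → A.length ≤ m → (∀ i, R (ρ i) ≤ m) →
    Runs (e.compile ρ d) (store A [] R) (e.timeBound.eval m)
      (store A [] (Function.update R d (e.eval A fun i => R (ρ i)))) := by
  induction e with
  | var i =>
    intro ρ d R m hρ hR hA hm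
    refine (runs_copyReg A R (hρ i).ne (hR d le_rfl)).mono ?_
    have := hm i
    simp only [timeBound, Polynomial.eval_add, Polynomial.eval_mul, Polynomial.eval_X,
      Polynomial.eval_ofNat]
    omega
  | one =>
    intro ρ d R m hρ hR hA hm
    have := runs_push_reg A [] R d
    rw [hR d le_rfl] at this
    simpa [timeBound, compile, eval] using this
  | len =>
    intro ρ d R m hρ hR hA hm
    refine (runs_lengthReg A R d (hR d le_rfl)).mono ?_
    simp only [timeBound, Polynomial.eval_add, Polynomial.eval_mul, Polynomial.eval_X,
      Polynomial.eval_ofNat]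
    omega
  | add a b iha ihb =>
    intro ρ d R m hρ hR hA hm
    have ha := iha ρ d R m hρ hR hA hm
    have hne : ∀ i, ρ i ≠ d := fun i => (hρ i).ne
    have hb := ihb ρ (d + 1) (Function.update R d (a.eval A fun i => R (ρ i))) m
      (fun i => (hρ i).trans (Nat.lt_succ_self d))
      (fun j hj => by
        rw [Function.update_of_ne (by omega)]; exact hR j (by omega)) hA
      (fun i => by rw [Function.update_of_ne (hne i)]; exact hm i)
    have ht := runs_transfer A [] (Function.update (Function.update R d
      (a.eval A fun i => R (ρ i))) (d + 1) (b.eval A fun i => R (ρ i))) (i := d + 1) (j := d)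
      (by omega)
    simp only [Function.update_of_ne (hne _)] at hb
    have hv := eval_le_valueBound A b hA hm
    have h := ha.seq (hb.seq ht)
    have e : Function.update (Function.update (Function.update (Function.update R d
        (a.eval A fun i => R (ρ i))) (d + 1) (b.eval A fun i => R (ρ i))) (d + 1) 0) d
        (a.eval A (fun i => R (ρ i)) + b.eval A (fun i => R (ρ i)))
        = Function.update R d ((add a b).eval A fun i => R (ρ i)) := by
      funext l
      by_cases h₁ : l = d
      · subst h₁; simp [eval]
      · by_cases h₂ : l = d + 1
        · subst h₂; simp [hR (d + 1) (by omega)]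
        · simp [h₁, h₂]
    simp only [Function.update_self, Function.update_of_ne (show d ≠ d + 1 by omega), e] at h
    refine h.mono ?_
    simp only [timeBound, Polynomial.eval_add, Polynomial.eval_mul, Polynomial.eval_one,
      Polynomial.eval_ofNat]
    omega
  | sub a b iha ihb =>
    intro ρ d R m hρ hR hA hm
    have ha := iha ρ d R m hρ hR hA hm
    have hne : ∀ i, ρ i ≠ d := fun i => (hρ i).ne
    have hb := ihb ρ (d + 1) (Function.update R d (a.eval A fun i => R (ρ i))) m
      (fun i => (hρ i).trans (Nat.lt_succ_self d))
      (fun j hj => by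
        rw [Function.update_of_ne (by omega)]; exact hR j (by omega)) hA
      (fun i => by rw [Function.update_of_ne (hne i)]; exact hm i)
    simp only [Function.update_of_ne (hne _)] at hb
    set x := a.eval A fun i => R (ρ i) with hx
    set y := b.eval A fun i => R (ρ i) with hy
    have ht := Runs.loop (key := d + 1 + 2) (p := seq (pop (d + 1 + 2)) (pop (d + 2)))
      (fun k => store A [] (Function.update (Function.update R d (x - (y - k))) (d + 1) k)) 2 y
      (by simp [store]) (by simp [store])
      (fun k hk => by
        have h := (runs_pop_reg A [] (Function.update (Function.update R d (x - (y - (k + 1))))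
          (d + 1) (k + 1)) (d + 1)).seq (runs_pop_reg A [] _ d)
        convert h using 2
        funext l
        by_cases h₁ : l = d
        · subst h₁; simp; omega
        · by_cases h₂ : l = d + 1
          · subst h₂; simp
          · simp [h₁, h₂])
    have hv := eval_le_valueBound A b hA hm
    have e : Function.update (Function.update R d (x - (y - 0))) (d + 1) 0
        = Function.update R d ((sub a b).eval A fun i => R (ρ i)) := by
      funext l
      by_cases h₁ : l = d
      · subst h₁; simp [eval, hx, hy]
      · by_cases h₂ : l = d + 1
        · subst h₂; simp [hR (d + 1) (by omega)]
        · simp [h₁, h₂]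
    simp only [Nat.sub_self, Nat.sub_zero] at ht
    rw [Nat.sub_zero] at e
    rw [e] at ht
    refine (ha.seq (hb.seq ht)).mono ?_
    simp only [timeBound, Polynomial.eval_add, Polynomial.eval_mul, Polynomial.eval_one,
      Polynomial.eval_ofNat]
    omega
  | read a iha =>
    intro ρ d R m hρ hR hA hm
    have ha := iha ρ d R m hρ hR hA hm
    have hr := runs_readReg A (Function.update R d (a.eval A fun i => R (ρ i))) d
    have hv := eval_le_valueBound A a hA hm
    simp only [Function.update_self, Function.update_idem] at hr
    refine (ha.seq hr).mono ?_
    simp only [timeBound, Polynomial.eval_add, Polynomial.eval_mul, Polynomial.eval_X,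
      Polynomial.eval_ofNat]
    omega
  | sum a f iha ihf =>
    intro ρ d R m hρ hR hA hm
    have hρ' : ∀ i, ρ i < d + 2 := fun i => (hρ i).trans (by omega)
    have ha := iha ρ (d + 2) R m hρ' (fun j hj => hR j (by omega)) hA hm
    have hv := eval_le_valueBound A a hA hm
    set n := a.eval A fun i => R (ρ i) with hn
    set g : ℕ → ℕ := fun i => f.eval A (scons i fun i => R (ρ i)) with hg
    -- the registers when `k` summands remain
    set S : ℕ → ℕ → ℕ := fun k => Function.update (Function.update (Function.update R d
      (∑ i ∈ Finset.range (n - k), g i)) (d + 1) (n - k)) (d + 2) k with hS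
    have hSd : ∀ k, S k d = ∑ i ∈ Finset.range (n - k), g i := fun k => by simp [hS]
    have hS1 : ∀ k, S k (d + 1) = n - k := fun k => by simp [hS]
    have hS2 : ∀ k, S k (d + 2) = k := fun k => by simp [hS]
    have hSo : ∀ k l, l ≠ d → l ≠ d + 1 → l ≠ d + 2 → S k l = R l := fun k l h₁ h₂ h₃ => by
      simp [hS, h₁, h₂, h₃]
    set T := f.timeBound.eval (m + a.valueBound.eval m) with hT
    set V := f.valueBound.eval (m + a.valueBound.eval m) with hV
    have hbody : ∀ k < n, Runs (seq (pop (d + 2 + 2))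
            (seq (compile f (scons (d + 1) ρ) (d + 3))
              (seq (loop (d + 3 + 2) (move (d + 3 + 2) (d + 2))) (push (d + 1 + 2) true))))
        (store A [] (S (k + 1))) (T + V * 2 + 3) (store A [] (S k)) := by
      intro k hk
      have h₁ := runs_pop_reg A [] (S (k + 1)) (d + 2)
      rw [hS2, Nat.add_sub_cancel] at h₁
      set R₁ := Function.update (S (k + 1)) (d + 2) k with hR₁
      have hR₁ρ : ∀ i, R₁ (ρ i) = R (ρ i) := fun i => by
        have := hρ i
        rw [hR₁, Function.update_of_ne (by omega), hSo _ _ (by omega) (by omega) (by omega)]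
      have hcons : (fun i => R₁ (scons (d + 1) ρ i)) = scons (n - (k + 1)) fun i => R (ρ i) := by
        funext i
        cases i with
        | zero => simp [scons, hR₁, hS1]
        | succ i => exact hR₁ρ i
      have hbd : ∀ i, R₁ (scons (d + 1) ρ i) ≤ m + a.valueBound.eval m := by
        intro i
        have := congrFun hcons i
        rw [this]
        cases i with
        | zero => simp only [scons]; omega
        | succ i => exact (hm i).trans (by omega)
      have h₂ := ihf (scons (d + 1) ρ) (d + 3) R₁ (m + a.valueBound.eval m)
        (fun i => by
          cases i with
          | zero => simp only [scons]; omega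
          | succ i => exact (hρ i).trans (by omega))
        (fun j hj => by
          rw [hR₁, Function.update_of_ne (by omega), hSo _ _ (by omega) (by omega) (by omega)]
          exact hR j (by omega))
        (by omega) hbd
      have hv' := eval_le_valueBound A f (by omega) hbd
      rw [hcons] at h₂ hv'
      have h₃ := runs_transfer A [] (Function.update R₁ (d + 3) (g (n - (k + 1)))) (i := d + 3)
        (j := d) (by omega)
      have h := h₁.seq (h₂.seq (h₃.seq (runs_push_reg A [] _ (d + 1))))
      have hfin : Function.update (Function.update (Function.update (Function.update R₁ (d + 3)
          (g (n - (k + 1)))) (d + 3) 0) d (R₁ d + g (n - (k + 1)))) (d + 1) (n - (k + 1) + 1)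
          = S k := by
        funext l
        by_cases e₀ : l = d
        · subst e₀
          rw [hSd, show n - k = n - (k + 1) + 1 by omega, Finset.sum_range_succ]
          simp [hR₁, hSd]
        · by_cases e₁ : l = d + 1
          · subst e₁
            rw [hS1, Function.update_self]
            omega
          · by_cases e₂ : l = d + 2
            · subst e₂; simp [hR₁, hS2]
            · rw [hSo k l e₀ e₁ e₂]
              by_cases e₃ : l = d + 3
              · subst e₃; simp [hR (d + 3) (by omega)]
              · simp [e₀, e₁, e₂, e₃, hR₁, hSo]
      have hR₁1 : R₁ (d + 1) = n - (k + 1) := by simp [hR₁, hS1]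
      simp only [Function.update_self,
        Function.update_of_ne (show d + 1 ≠ d by omega),
        Function.update_of_ne (show d + 1 ≠ d + 3 by omega),
        Function.update_of_ne (show d ≠ d + 3 by omega), hR₁1, hfin] at h
      refine h.mono ?_
      change g (n - (k + 1)) ≤ V at hv'
      omega
    have hl := Runs.loop (key := d + 2 + 2) (fun k => store A [] (S k)) _ n
      (by simp [store, hS2]) (by simp [store, hS2]) hbody
    have hc := runs_clear_reg A [] (S 0) (d + 1)
    have e₁ : Function.update R (d + 2) n = S n := by
      funext l
      by_cases e₀ : l = d
      · subst e₀; simp [hSd, hR]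
      · by_cases e₁ : l = d + 1
        · subst e₁; simp [hS1, hR]
        · by_cases e₂ : l = d + 2
          · subst e₂; simp [hS2]
          · simp [hSo, e₀, e₁, e₂]
    have e₂ : Function.update (S 0) (d + 1) 0
        = Function.update R d ((sum a f).eval A fun i => R (ρ i)) := by
      funext l
      by_cases e₀ : l = d
      · subst e₀; simp [hSd, eval, hn, hg]
      · by_cases e₁ : l = d + 1
        · subst e₁; simp [hR]
        · by_cases e₂ : l = d + 2
          · subst e₂; simp [hS2, hR]
          · simp [hSo, e₀, e₁, e₂]
    rw [hS1, e₂, Nat.sub_zero] at hc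
    rw [e₁] at ha
    refine (ha.seq (hl.seq hc)).mono ?_
    simp only [timeBound, Polynomial.eval_add, Polynomial.eval_mul, Polynomial.eval_ofNat,
      Polynomial.eval_comp, Polynomial.eval_X]
    rw [← hT, ← hV]
    have := Nat.mul_le_mul_right (T + V * 2 + 4) hv
    have e : T + V * 2 + 3 + 1 = T + V * 2 + 4 := rfl
    rw [e]
    omega

end Expr

/-! ### Iteration of an expression in polynomial time -/

namespace Expr

/-- One round of the iteration of an expression: the truth value of the expression is put in front
of the list. All variables have the value `N`. -/
def extend (e : Expr) (N : ℕ) (A : List Bool) : List Bool :=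
  decide (e.eval A (fun _ => N) ≠ 0) :: A

theorem length_iterate_extend (e : Expr) (N : ℕ) (A : List Bool) (t : ℕ) :
    ((e.extend N)^[t] A).length = t + A.length := by
  induction t with
  | zero => simp
  | succ t ih => rw [Function.iterate_succ_apply', extend, List.length_cons, ih]; omega

open StackProg

/-- A program that iterates the expression `e` on the input as often as the expression `b` says,
and returns the truth value obtained last. Register `0` holds the length of the input, register `1`
the remaining number of rounds. -/
def iterProg (e b : Expr) : StackProg :=
  seq (lengthReg 0)
    (seq (compile b (fun _ => 0) 1)
      (seq
        (loop (1 + 2)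
          (seq (pop (1 + 2))
            (seq (compile e (fun _ => 0) 2)
              (ite (2 + 2) (seq (loop (2 + 2) (pop (2 + 2))) (push 0 true)) (push 0 false)))))
        (seq (ite 0 (push 1 true) (push 1 false))
          (seq (loop 0 (pop 0)) (loop (0 + 2) (pop (0 + 2)))))))

theorem runs_clear_zero (A B : List Bool) (R : ℕ → ℕ) :
    Runs (loop 0 (pop 0)) (store A B R) (A.length * 2 + 1) (store [] B R) := by
  induction A with
  | nil => exact ⟨1, by simp, Exec.loopDone rfl⟩
  | cons b A ih =>
    obtain ⟨t₁, ht₁, h₁⟩ := runs_pop_zero (b :: A) B R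
    obtain ⟨t₂, ht₂, h₂⟩ := ih
    exact ⟨1 + t₁ + t₂, by simp only [List.length_cons]; omega,
      Exec.loopStep (by simp [store]) h₁ h₂⟩

open Polynomial in
/-- A polynomial bound on the time of the program `iterProg e b`. -/
noncomputable def iterTime (e b : Expr) : Polynomial ℕ :=
  X * 5 + 2 + b.timeBound
    + b.valueBound * (e.timeBound.comp (X + b.valueBound)
        + e.valueBound.comp (X + b.valueBound) * 2 + 5)
    + (X + b.valueBound) * 2 + X * 2 + 6

theorem runs_iterProg (e b : Expr) (x : List Bool) :
    Runs (iterProg e b) (store x [] fun _ => 0) ((iterTime e b).eval x.length)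
      (store [] [decide (((e.extend x.length)^[b.eval x fun _ => x.length] x).head? = some true)]
        fun _ => 0) := by
  set N := x.length with hN
  set n := b.eval x fun _ => N with hn
  -- the registers when `k` rounds remain
  set R : ℕ → ℕ → ℕ := fun k => Function.update (Function.update (fun _ => 0) 0 N) 1 k with hR
  have hR0 : ∀ k, R k 0 = N := fun k => by simp [hR]
  have hR1 : ∀ k, R k 1 = k := fun k => by simp [hR]
  have hR2 : ∀ k j, 2 ≤ j → R k j = 0 := fun k j hj => by
    simp [hR, show j ≠ 0 by omega, show j ≠ 1 by omega]
  have h₁ := runs_lengthReg x (fun _ => 0) 0 rfl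
  have h₂ := runs_compile x b (fun _ => 0) 1 (Function.update (fun _ => 0) 0 N) N (fun _ => by simp)
    (fun j hj => by simp [show j ≠ 0 by omega]) le_rfl (fun _ => by simp)
  have hv : n ≤ b.valueBound.eval N := eval_le_valueBound x b le_rfl fun _ => le_rfl
  set M := N + b.valueBound.eval N with hM
  set T := e.timeBound.eval M with hT
  set V := e.valueBound.eval M with hV
  have hbody : ∀ k < n, Runs (seq (pop (1 + 2)) (seq (compile e (fun _ => 0) 2)
      (ite (2 + 2) (seq (loop (2 + 2) (pop (2 + 2))) (push 0 true)) (push 0 false))))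
      (store ((e.extend N)^[n - (k + 1)] x) [] (R (k + 1))) (T + V * 2 + 4)
      (store ((e.extend N)^[n - k] x) [] (R k)) := by
    intro k hk
    set A := (e.extend N)^[n - (k + 1)] x with hA
    have hA' : (e.extend N)^[n - k] x = decide (e.eval A (fun _ => N) ≠ 0) :: A := by
      rw [show n - k = n - (k + 1) + 1 by omega, Function.iterate_succ_apply']
      rfl
    have hAlen : A.length ≤ M := by
      rw [hA, length_iterate_extend]
      omega
    have h₁ := runs_pop_reg A [] (R (k + 1)) 1
    have e₁ : Function.update (R (k + 1)) 1 (R (k + 1) 1 - 1) = R k := by simp [hR]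
    rw [e₁] at h₁
    have h₂ := runs_compile A e (fun _ => 0) 2 (R k) M (fun _ => by simp)
      (fun j hj => hR2 k j hj) hAlen (fun _ => by simp only [hR0]; omega)
    have hv : e.eval A (fun _ => N) ≤ V :=
      eval_le_valueBound A e hAlen fun _ => by omega
    simp only [hR0] at h₂
    rw [hA']
    set y := e.eval A fun _ => N with hy
    have h₃ : Runs (ite (2 + 2) (seq (loop (2 + 2) (pop (2 + 2))) (push 0 true)) (push 0 false))
        (store A [] (Function.update (R k) 2 y)) (y * 2 + 3)
        (store (decide (y ≠ 0) :: A) [] (R k)) := by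
      by_cases h0 : y = 0
      · obtain ⟨t, ht, h⟩ := runs_push_zero A [] (Function.update (R k) 2 y) false
        refine ⟨1 + t, by omega, Exec.iteFalse ?_ ?_⟩
        · rw [h0]; simp [store]
        · have : Function.update (R k) 2 y = R k := by
            rw [h0, ← hR2 k 2 le_rfl, Function.update_eq_self]
          rw [this] at h ⊢
          simpa [h0] using h
      · obtain ⟨t, ht, h⟩ := (runs_clear_reg A [] (Function.update (R k) 2 y) 2).seq
          (runs_push_zero A [] _ true)
        simp only [Function.update_self] at ht
        refine ⟨1 + t, by omega, Exec.iteTrue ?_ ?_⟩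
        · obtain ⟨z, hz⟩ := Nat.exists_eq_succ_of_ne_zero h0
          rw [hz]; simp [store, List.replicate_succ]
        · have : Function.update (R k) 2 0 = R k := by
            rw [← hR2 k 2 le_rfl, Function.update_eq_self]
          rw [Function.update_idem, this] at h
          simpa [h0] using h
    exact (h₁.seq (h₂.seq h₃)).mono (by omega)
  have hl := Runs.loop (key := 1 + 2) (fun k => store ((e.extend N)^[n - k] x) [] (R k)) _ n
    (by simp [store, hR1]) (by simp [store, hR1]) hbody
  simp only [Nat.sub_self, Nat.sub_zero, Function.iterate_zero, id_eq] at hl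
  set A := (e.extend N)^[n] x with hA
  have hAlen : A.length = n + N := length_iterate_extend e N x n
  have h₃ : Runs (ite 0 (push 1 true) (push 1 false)) (store A [] (R 0)) 2
      (store A [decide (A.head? = some true)] (R 0)) := by
    by_cases h : A.head? = some true
    · obtain ⟨t, ht, h'⟩ := runs_push_one A [] (R 0) true
      exact ⟨1 + t, by omega, Exec.iteTrue h (by simpa [h] using h')⟩
    · obtain ⟨t, ht, h'⟩ := runs_push_one A [] (R 0) false
      exact ⟨1 + t, by omega, Exec.iteFalse h (by simpa [h] using h')⟩
  have h₄ := runs_clear_zero A [decide (A.head? = some true)] (R 0)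
  have h₅ := runs_clear_reg [] [decide (A.head? = some true)] (R 0) 0
  have e₅ : Function.update (R 0) 0 0 = fun _ => 0 := by
    funext j
    match j with
    | 0 => simp
    | 1 => simp [hR]
    | j + 2 => simp [hR]
  rw [e₅, hR0] at h₅
  refine (h₁.seq (h₂.seq (hl.seq (h₃.seq (h₄.seq h₅))))).mono ?_
  simp only [iterTime, Polynomial.eval_add, Polynomial.eval_mul, Polynomial.eval_ofNat,
    Polynomial.eval_comp, Polynomial.eval_X]
  rw [hAlen, ← hM, ← hT, ← hV]
  have := Nat.mul_le_mul_right (T + V * 2 + 5) hv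
  have e : T + V * 2 + 4 + 1 = T + V * 2 + 5 := rfl
  rw [e]
  omega

/-- Iterating an expression a polynomial number of times on the input, with all truth values
obtained so far available, decides a language in polynomial time. -/
theorem decidableInPolyTime (e b : Expr) {X : Language Bool}
    (h : ∀ x : List Bool,
      ((e.extend x.length)^[b.eval x fun _ => x.length] x).head? = some true ↔ x ∈ X) :
    DecidableInPolyTime X := by
  refine StackProg.decidableInPolyTime (iterProg e b) (iterTime e b)
    (fun x => decide (((e.extend x.length)^[b.eval x fun _ => x.length] x).head? = some true))
    (fun x => by simpa using h x) fun x => ?_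
  have h₀ : Function.update (fun _ => []) 0 x = store x [] fun _ => 0 := by
    funext k
    match k with
    | 0 => rfl
    | 1 => rfl
    | j + 2 => rfl
  have h₁ : ∀ b : Bool, Function.update (fun _ => []) 1 [b] = store [] [b] fun _ => 0 := by
    intro b
    funext k
    match k with
    | 0 => rfl
    | 1 => rfl
    | j + 2 => rfl
  rw [h₀, h₁]
  exact runs_iterProg e b x

end Expr

/-! ### Definable functions and predicates -/

/-- A context for expressions: every element of `σ` determines a bit list and the values of the
variables. -/
structure ExprContext (σ : Type) : Type where
  /-- the bit list -/
  list : σ → List Bool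
  /-- the variables -/
  var : ℕ → σ → ℕ

/-- The context with an additional variable, which becomes variable `0`. -/
def ExprContext.push {σ : Type} (C : ExprContext σ) : ExprContext (σ × ℕ) where
  list p := C.list p.1
  var i p := Expr.scons p.2 (fun j => C.var j p.1) i

namespace Expr

/-- Renaming of the variables. -/
def rename : Expr → (ℕ → ℕ) → Expr
  | var i, r => var (r i)
  | one, _ => one
  | len, _ => len
  | add a b, r => add (a.rename r) (b.rename r)
  | sub a b, r => sub (a.rename r) (b.rename r)
  | sum a f, r => sum (a.rename r) (f.rename (scons 0 fun i => r i + 1))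
  | read a, r => read (a.rename r)

theorem eval_rename (A : List Bool) (e : Expr) : ∀ (r v : ℕ → ℕ),
    (e.rename r).eval A v = e.eval A fun i => v (r i) := by
  induction e with
  | var i => intro r v; rfl
  | one => intro r v; rfl
  | len => intro r v; rfl
  | add a b iha ihb => intro r v; simp only [rename, eval, iha, ihb]
  | sub a b iha ihb => intro r v; simp only [rename, eval, iha, ihb]
  | sum a f iha ihf =>
    intro r v
    simp only [rename, eval, iha, ihf]
    refine Finset.sum_congr rfl fun i _ => congrArg _ (funext fun j => ?_)
    cases j <;> rfl
  | read a iha => intro r v; simp only [rename, eval, iha]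

end Expr

/-- A function is definable in a context if it is the value of an expression. -/
def Definable {σ : Type} (C : ExprContext σ) (f : σ → ℕ) : Prop :=
  ∃ e : Expr, ∀ s, e.eval (C.list s) (fun i => C.var i s) = f s

open Classical in
/-- A predicate is definable in a context if its characteristic function is. -/
def DefinablePred {σ : Type} (C : ExprContext σ) (P : σ → Prop) : Prop :=
  Definable C fun s => if P s then 1 else 0

section Definable

variable {σ : Type} {C : ExprContext σ} {f g : σ → ℕ} {P Q : σ → Prop}

theorem Definable.congr (hf : Definable C f) (h : ∀ s, f s = g s) : Definable C g := by
  rwa [← funext h]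

theorem Definable.var (i : ℕ) : Definable C (C.var i) := ⟨.var i, fun _ => rfl⟩

theorem Definable.last : Definable C.push fun p => p.2 := ⟨.var 0, fun _ => rfl⟩

theorem Definable.weaken (hf : Definable C f) : Definable C.push fun p => f p.1 := by
  obtain ⟨e, he⟩ := hf
  exact ⟨e.rename (· + 1), fun p => (Expr.eval_rename _ _ _ _).trans (he p.1)⟩

theorem Definable.length : Definable C fun s => (C.list s).length := ⟨.len, fun _ => rfl⟩

theorem Definable.add (hf : Definable C f) (hg : Definable C g) :
    Definable C fun s => f s + g s := by
  obtain ⟨e, he⟩ := hf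
  obtain ⟨e', he'⟩ := hg
  exact ⟨e.add e', fun s => congrArg₂ _ (he s) (he' s)⟩

theorem Definable.sub (hf : Definable C f) (hg : Definable C g) :
    Definable C fun s => f s - g s := by
  obtain ⟨e, he⟩ := hf
  obtain ⟨e', he'⟩ := hg
  exact ⟨e.sub e', fun s => congrArg₂ _ (he s) (he' s)⟩

theorem Definable.sum {h : σ → ℕ → ℕ} (hf : Definable C f)
    (hh : Definable C.push fun p => h p.1 p.2) :
    Definable C fun s => ∑ i ∈ Finset.range (f s), h s i := by
  obtain ⟨e, he⟩ := hf
  obtain ⟨e', he'⟩ := hh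
  refine ⟨e.sum e', fun s => ?_⟩
  rw [Expr.eval, he]
  exact Finset.sum_congr rfl fun i _ => he' (s, i)

theorem Definable.const (c : ℕ) : Definable C fun _ => c := by
  induction c with
  | zero => exact ⟨.sub .one .one, fun _ => rfl⟩
  | succ c ih => exact ih.add ⟨.one, fun _ => rfl⟩

theorem Definable.mul (hf : Definable C f) (hg : Definable C g) :
    Definable C fun s => f s * g s :=
  (hf.sum (h := fun s _ => g s) hg.weaken).congr fun s => by simp

theorem DefinablePred.congr (hP : DefinablePred C P) (h : ∀ s, P s ↔ Q s) : DefinablePred C Q := by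
  rwa [← funext fun s => propext (h s)]

theorem DefinablePred.read (hf : Definable C f) :
    DefinablePred C fun s => (C.list s)[f s]? = some true := by
  obtain ⟨e, he⟩ := hf
  refine ⟨e.read, fun s => ?_⟩
  rw [Expr.eval, he]
  congr

theorem DefinablePred.le (hf : Definable C f) (hg : Definable C g) :
    DefinablePred C fun s => f s ≤ g s :=
  ((Definable.const 1).sub (hf.sub hg)).congr fun s => by split <;> omega

theorem DefinablePred.lt (hf : Definable C f) (hg : Definable C g) :
    DefinablePred C fun s => f s < g s :=
  DefinablePred.le (hf.add (Definable.const 1)) hg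

theorem DefinablePred.not (hP : DefinablePred C P) : DefinablePred C fun s => ¬ P s :=
  ((Definable.const 1).sub hP).congr fun s => by by_cases h : P s <;> simp [h]

theorem DefinablePred.and (hP : DefinablePred C P) (hQ : DefinablePred C Q) :
    DefinablePred C fun s => P s ∧ Q s :=
  (Definable.mul hP hQ).congr fun s => by by_cases h : P s <;> by_cases h' : Q s <;> simp [h, h']

theorem DefinablePred.or (hP : DefinablePred C P) (hQ : DefinablePred C Q) :
    DefinablePred C fun s => P s ∨ Q s :=
  (hP.not.and hQ.not).not.congr fun s => by tauto

theorem DefinablePred.eq (hf : Definable C f) (hg : Definable C g) :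
    DefinablePred C fun s => f s = g s :=
  ((DefinablePred.le hf hg).and (DefinablePred.le hg hf)).congr fun s => by omega

open Classical in
theorem Definable.ite (hP : DefinablePred C P) (hf : Definable C f) (hg : Definable C g) :
    Definable C fun s => if P s then f s else g s :=
  ((Definable.mul hP hf).add (Definable.mul hP.not hg)).congr fun s => by
    by_cases h : P s <;> simp [h]

theorem DefinablePred.exists_lt {R : σ → ℕ → Prop} (hf : Definable C f)
    (hR : DefinablePred C.push fun p => R p.1 p.2) :
    DefinablePred C fun s => ∃ i < f s, R s i := by
  classical
  refine (DefinablePred.lt (Definable.const 0)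
    (Definable.sum (h := fun s i => if R s i then 1 else 0) hf (Definable.congr hR fun p => by
      congr))).congr fun s => ?_
  rw [Finset.sum_boole, Nat.cast_id, Finset.card_pos]
  simp [Finset.Nonempty]

theorem DefinablePred.forall_lt {R : σ → ℕ → Prop} (hf : Definable C f)
    (hR : DefinablePred C.push fun p => R p.1 p.2) :
    DefinablePred C fun s => ∀ i < f s, R s i :=
  (DefinablePred.exists_lt (R := fun s i => ¬ R s i) hf hR.not).not.congr fun s => by
    push Not; rfl

/-- The sum in the proof is the quotient. For a divisor `0` it has some other value, but then it is
multiplied by `0`. -/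
theorem Definable.mod (hf : Definable C f) (hg : Definable C g) :
    Definable C fun s => f s % g s := by
  have h : Definable C fun s =>
      f s - g s * ∑ i ∈ Finset.range (f s), if (i + 1) * g s ≤ f s then 1 else 0 :=
    hf.sub (hg.mul (hf.sum (Definable.congr (DefinablePred.le
      ((Definable.last.add (Definable.const 1)).mul hg.weaken) hf.weaken) fun p => by
        congr)))
  refine h.congr fun s => ?_
  rcases Nat.eq_zero_or_pos (g s) with h0 | h0
  · simp [h0]
  · rw [Finset.sum_boole, Nat.cast_id]
    have : (Finset.range (f s)).filter (fun i => (i + 1) * g s ≤ f s)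
        = Finset.range (f s / g s) := by
      ext i
      simp only [Finset.mem_filter, Finset.mem_range]
      rw [← Nat.le_div_iff_mul_le h0]
      have := Nat.div_le_self (f s) (g s)
      omega
    rw [this, Finset.card_range]
    have := Nat.div_add_mod (f s) (g s)
    omega

end Definable

/-! ### Synchronization and joint reachability of pairs of states -/

namespace DVPDA

variable {Q C I R G : Type} {M : DVPDA Q C I R G}

/-- `M.Joint k p q p' q'`: some word leads from the state `p` to the state `p'` and at the same time
from `q` to `q'`. For `k = false` the word is well-matched, and for `k = true` it is a word without
unmatched call letters that is read with the empty stack. -/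
inductive Joint (M : DVPDA Q C I R G) : Bool → Q → Q → Q → Q → Prop
  | refl (k : Bool) (p q : Q) : Joint M k p q p q
  | int (k : Bool) (p q : Q) (b : I) : Joint M k p q (M.intTrans p b) (M.intTrans q b)
  | trans {k : Bool} {p q p₁ q₁ p₂ q₂ : Q} :
      Joint M k p q p₁ q₁ → Joint M k p₁ q₁ p₂ q₂ → Joint M k p q p₂ q₂
  | nest (k : Bool) (p q : Q) (a : C) (d : R) {p₁ q₁ : Q} :
      Joint M false (M.callTrans p a).1 (M.callTrans q a).1 p₁ q₁ →
      Joint M k p q (M.retTrans p₁ d (M.callTrans p a).2) (M.retTrans q₁ d (M.callTrans q a).2)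
  | bot (p q : Q) (d : R) : Joint M true p q (M.retTrans p d ⊥) (M.retTrans q d ⊥)

/-- A well-matched word can be read with the empty stack. -/
theorem Joint.toTrue {k : Bool} {p q p' q' : Q} (h : M.Joint k p q p' q') :
    M.Joint true p q p' q' := by
  induction h with
  | refl => exact .refl _ _ _
  | int => exact .int _ _ _ _
  | trans _ _ ih₁ ih₂ => exact ih₁.trans ih₂
  | nest k p q a d h _ => exact .nest _ _ _ _ _ h
  | bot => exact .bot _ _ _

theorem Step.eq_of_call {p : Q} {a : C} {s : List (WithBot G)} {y : Q × List (WithBot G)}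
    (h : M.Step (p, s) (.call a) y) : y = ((M.callTrans p a).1, ↑(M.callTrans p a).2 :: s) := by
  cases h
  rfl

theorem Step.eq_of_int {p : Q} {b : I} {s : List (WithBot G)} {y : Q × List (WithBot G)}
    (h : M.Step (p, s) (.int b) y) : y = (M.intTrans p b, s) := by
  cases h
  rfl

theorem Run.append {x y z : Q × List (WithBot G)} {u v : List (VisLetter C I R)}
    (h₁ : M.Run x u y) (h₂ : M.Run y v z) : M.Run x (u ++ v) z := by
  induction h₁ with
  | nil => exact h₂
  | cons hs _ ih => exact .cons hs (ih h₂)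

theorem Run.single {x y : Q × List (WithBot G)} {l : VisLetter C I R} (h : M.Step x l y) :
    M.Run x [l] y :=
  .cons h (.nil _)

/-- A jointly reachable pair is reached by a word that acts as a map on all states. -/
theorem Joint.exists_word {k : Bool} {p q p' q' : Q} (h : M.Joint k p q p' q') :
    ∃ (w : List (VisLetter C I R)) (f : Q → Q), f p = p' ∧ f q = q' ∧
      ∀ (x : Q) (s : List (WithBot G)), (k = true → s = [⊥]) → M.Run (x, s) w (f x, s) := by
  induction h with
  | refl k p q => exact ⟨[], id, rfl, rfl, fun x s _ => .nil _⟩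
  | int k p q b =>
    exact ⟨[.int b], fun x => M.intTrans x b, rfl, rfl, fun x s _ => .single (.int x b s)⟩
  | trans _ _ ih₁ ih₂ =>
    obtain ⟨w₁, f₁, rfl, rfl, h₁⟩ := ih₁
    obtain ⟨w₂, f₂, rfl, rfl, h₂⟩ := ih₂
    exact ⟨w₁ ++ w₂, f₂ ∘ f₁, rfl, rfl, fun x s hs => (h₁ x s hs).append (h₂ _ s hs)⟩
  | nest k p q a d _ ih =>
    obtain ⟨w, f, rfl, rfl, h⟩ := ih
    refine ⟨.call a :: (w ++ [.ret d]),
      fun x => M.retTrans (f (M.callTrans x a).1) d (M.callTrans x a).2, rfl, rfl,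
      fun x s _ => ?_⟩
    exact .cons (.call x a s) ((h _ _ (by simp)).append (.single (.retPop _ d _ s)))
  | bot p q d =>
    refine ⟨[.ret d], fun x => M.retTrans x d ⊥, rfl, rfl, fun x s hs => ?_⟩
    rw [hs rfl]
    exact .single (.retBot x d [])

/-- Joint reachability of a pair of states with the empty stack from a pair of states with stacks
that hold, above the bottom symbol, the symbols in the two lists: every symbol is removed by
a return letter after a well-matched word. -/
def JointFrom (M : DVPDA Q C I R G) : List G → List G → Q → Q → Q → Q → Prop
  | [], [], p, q, p', q' => M.Joint true p q p' q'
  | γ :: u, γ' :: v, p, q, p', q' => ∃ (p₁ q₁ : Q) (d : R), M.Joint false p q p₁ q₁ ∧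
      JointFrom M u v (M.retTrans p₁ d γ) (M.retTrans q₁ d γ') p' q'
  | _, _, _, _, _, _ => False

theorem JointFrom.prepend {u v : List G} {p q p₁ q₁ p' q' : Q} (h : M.Joint false p q p₁ q₁)
    (h' : M.JointFrom u v p₁ q₁ p' q') : M.JointFrom u v p q p' q' := by
  match u, v with
  | [], [] => exact h.toTrue.trans h'
  | γ :: u, γ' :: v =>
    obtain ⟨p₂, q₂, d, h₁, h₂⟩ := h'
    exact ⟨p₂, q₂, d, h.trans h₁, h₂⟩
  | [], _ :: _ => exact h'.elim
  | _ :: _, [] => exact h'.elim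

/-- Two runs on the same word have the same stack height at all times, so that the word can be cut
at the same places for both. -/
theorem jointFrom_of_run (w : List (VisLetter C I R)) : ∀ {u v : List G} {p q p' q' : Q},
    u.length = v.length →
    M.Run (p, u.map (↑) ++ [⊥]) w (p', [⊥]) → M.Run (q, v.map (↑) ++ [⊥]) w (q', [⊥]) →
    M.JointFrom u v p q p' q' := by
  induction w with
  | nil =>
    intro u v p q p' q' huv hp hq
    cases u with
    | cons γ u => cases hp
    | nil =>
      cases v with
      | cons γ v => cases hq
      | nil =>
        cases hp
        cases hq
        exact Joint.refl _ _ _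
  | cons l w ih =>
    intro u v p q p' q' huv hp hq
    obtain _ | ⟨sp, hp⟩ := hp
    obtain _ | ⟨sq, hq⟩ := hq
    cases l with
    | call a =>
      rw [sp.eq_of_call] at hp
      rw [sq.eq_of_call] at hq
      obtain ⟨p₁, q₁, d, h₁, h₂⟩ := ih (u := (M.callTrans p a).2 :: u)
        (v := (M.callTrans q a).2 :: v) (by simpa using huv) hp hq
      exact h₂.prepend (.nest _ _ _ _ _ h₁)
    | int b =>
      rw [sp.eq_of_int] at hp
      rw [sq.eq_of_int] at hq
      exact (ih huv hp hq).prepend (.int _ _ _ _)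
    | ret d =>
      match u, v with
      | [], [] =>
        have hp' : M.Run (M.retTrans p d ⊥, [⊥]) w (p', [⊥]) := by cases sp; exact hp
        have hq' : M.Run (M.retTrans q d ⊥, [⊥]) w (q', [⊥]) := by cases sq; exact hq
        exact (Joint.bot p q d).trans (ih (u := []) (v := []) rfl hp' hq')
      | γ :: u, γ' :: v =>
        have hp' : M.Run (M.retTrans p d γ, u.map (↑) ++ [⊥]) w (p', [⊥]) := by cases sp; exact hp
        have hq' : M.Run (M.retTrans q d γ', v.map (↑) ++ [⊥]) w (q', [⊥]) := by cases sq; exact hq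
        exact ⟨p, q, d, .refl _ _ _, ih (by simpa using huv) hp' hq'⟩
      | [], _ :: _ => simp at huv
      | _ :: _, [] => simp at huv

/-- A set of selfmaps of a finite set that contains the identity, is closed under composition, and
for every two points contains a map that merges them, contains a constant map. -/
theorem exists_const_of_merging [Finite Q] [Nonempty Q] (F : Set (Q → Q)) (hid : id ∈ F)
    (hcomp : ∀ f ∈ F, ∀ g ∈ F, g ∘ f ∈ F) (hmerge : ∀ p q, ∃ f ∈ F, f p = f q) :
    ∃ f ∈ F, ∃ r, ∀ q, f q = r := by
  classical
  have := Fintype.ofFinite Q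
  obtain ⟨m, hm, hmin⟩ := exists_minimal_of_wellFoundedLT (α := ℕ)
    (fun m => ∃ f ∈ F, (Finset.univ.image f).card = m) ⟨_, id, hid, rfl⟩
  obtain ⟨g, hg, rfl⟩ := hm
  refine ⟨g, hg, g (Classical.arbitrary Q), fun q => ?_⟩
  by_contra hne
  obtain ⟨h, hh, e⟩ := hmerge (g q) (g (Classical.arbitrary Q))
  have h₁ := hmin ⟨h ∘ g, hcomp g hg h hh, rfl⟩
  have h₂ : (Finset.univ.image (h ∘ g)).card < (Finset.univ.image g).card := by
    rw [← Finset.image_image]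
    refine lt_of_le_of_ne Finset.card_image_le fun hc => hne ?_
    exact Finset.card_image_iff.1 hc (by simp) (by simp) e
  have := h₁ h₂.le
  omega

/-- There is a synchronizing word in the empty stack model if and only if every two states can be
merged. -/
theorem exists_synchronizesEmpty_iff [Finite Q] :
    (∃ w, M.SynchronizesEmpty w) ↔ Nonempty Q ∧ ∀ p q, ∃ r, M.Joint true p q r r := by
  constructor
  · rintro ⟨w, r, hr⟩
    exact ⟨⟨r⟩, fun p q => ⟨r, jointFrom_of_run w (u := []) (v := []) rfl (hr p) (hr q)⟩⟩
  · rintro ⟨hQ, h⟩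
    obtain ⟨f, ⟨w, hw⟩, r, hr⟩ := exists_const_of_merging
      {f | ∃ w, ∀ x, M.Run (x, [⊥]) w (f x, [⊥])} ⟨[], fun x => .nil _⟩
      (fun f ⟨w₁, h₁⟩ g ⟨w₂, h₂⟩ => ⟨w₁ ++ w₂, fun x => (h₁ x).append (h₂ _)⟩)
      (fun p q => by
        obtain ⟨r, hr⟩ := h p q
        obtain ⟨w, f, hp, hq, hf⟩ := hr.exists_word
        exact ⟨f, ⟨w, fun x => hf x _ fun _ => rfl⟩, hp.trans hq.symm⟩)
    exact ⟨w, r, fun q => hr q ▸ hw q⟩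

end DVPDA

/-! ### Fixed points by recording facts in turn -/

/-- Suppose that the facts are the numbers below `M`, that `R K f` means that the fact `f` follows
from the facts in `K`, and that at time `t` the fact `t % M` is checked and recorded if it follows
from the facts recorded before. Then after `M + 1` rounds the recorded facts are the smallest
closed set: as long as the set is not closed, each round adds a fact. -/
theorem recorded_closed_and_least (M : ℕ) (R : Set ℕ → ℕ → Prop)
    (hmono : ∀ ⦃K K' : Set ℕ⦄ ⦃f : ℕ⦄, K ⊆ K' → R K f → R K' f) (h : ℕ → Prop)
    (hh : ∀ t < M * (M + 1), h t ↔ R {f | ∃ i < t, i % M = f ∧ h i} (t % M)) :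
    (∀ f < M, R {f | ∃ i < M * (M + 1), i % M = f ∧ h i} f →
      ∃ i < M * (M + 1), i % M = f ∧ h i) ∧
    ∀ D : Set ℕ, (∀ f, R D f → f ∈ D) → {f | ∃ i < M * (M + 1), i % M = f ∧ h i} ⊆ D := by
  classical
  constructor
  · rcases Nat.eq_zero_or_pos M with rfl | hM
    · intro f hf
      omega
    -- the facts recorded before round `r`
    let K : ℕ → Finset ℕ := fun r => (Finset.range M).filter fun f => ∃ i < r * M, i % M = f ∧ h i
    have hK : ∀ r, (K r : Set ℕ) = {f | ∃ i < r * M, i % M = f ∧ h i} := by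
      intro r
      ext f
      simp only [K, Finset.coe_filter, Finset.mem_range, Set.mem_ofPred_eq, and_iff_right_iff_imp]
      rintro ⟨i, _, rfl, _⟩
      exact Nat.mod_lt _ hM
    have hsub : ∀ r, K r ⊆ K (r + 1) := by
      intro r f hf
      simp only [K, Finset.mem_filter] at hf ⊢
      obtain ⟨hf, i, hi, e, hi'⟩ := hf
      exact ⟨hf, i, hi.trans_le (Nat.mul_le_mul_right _ (by omega)), e, hi'⟩
    -- the sets `K 0, …, K (M + 1)` increase and have at most `M` elements
    have hex : ∃ r ≤ M, K (r + 1) = K r := by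
      by_contra! hne
      have hcard : ∀ r ≤ M + 1, r ≤ (K r).card := by
        intro r
        induction r with
        | zero => simp
        | succ r ih =>
          intro hr
          have := Finset.card_lt_card ((hsub r).ssubset_of_ne (hne r (by omega)).symm)
          have := ih (by omega)
          omega
      have h₁ := hcard (M + 1) le_rfl
      have h₂ : (K (M + 1)).card ≤ M := by
        simpa using Finset.card_le_card (Finset.filter_subset _ _ : K (M + 1) ⊆ Finset.range M)
      omega
    obtain ⟨r, hr, he⟩ := hex
    have hrM : r * M + M ≤ M * (M + 1) := by nlinarith
    have hclosed : ∀ f < M, R (K r) f → f ∈ K r := by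
      intro f hf hRf
      rw [← he]
      simp only [K, Finset.mem_filter, Finset.mem_range]
      have hmod : (r * M + f) % M = f := by
        rw [Nat.add_comm, Nat.add_mul_mod_self_right, Nat.mod_eq_of_lt hf]
      refine ⟨hf, r * M + f, by rw [Nat.succ_mul]; omega, hmod, ?_⟩
      rw [hh _ (by omega), hmod]
      refine hmono ?_ hRf
      rw [hK]
      rintro f ⟨i, hi, e, hi'⟩
      exact ⟨i, by omega, e, hi'⟩
    -- nothing outside the closed set `K r` is ever recorded
    have hconst : ∀ i < M * (M + 1), h i → i % M ∈ K r := by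
      intro i
      induction i using Nat.strong_induction_on with
      | _ i ih =>
        intro hi hi'
        refine hclosed _ (Nat.mod_lt _ hM) (hmono ?_ ((hh i hi).1 hi'))
        rintro f ⟨j, hj, rfl, hj'⟩
        exact ih j hj (by omega) hj'
    intro f hf hRf
    have hf' : f ∈ K r := by
      refine hclosed f hf (hmono ?_ hRf)
      rintro f ⟨i, hi, rfl, hi'⟩
      exact hconst i hi hi'
    simp only [K, Finset.mem_filter] at hf'
    obtain ⟨_, i, hi, e, hi'⟩ := hf'
    exact ⟨i, by omega, e, hi'⟩
  · intro D hD
    have key : ∀ i < M * (M + 1), h i → i % M ∈ D := by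
      intro i
      induction i using Nat.strong_induction_on with
      | _ i ih =>
        intro hi hi'
        refine hD _ (hmono ?_ ((hh i hi).1 hi'))
        rintro f ⟨j, hj, rfl, hj'⟩
        exact ih j hj (by omega) hj'
    rintro f ⟨i, hi, rfl, hi'⟩
    exact key i hi hi'

/-! ### Lists of numbers in unary -/

namespace UnaryCode

/-- The number of entries other than `true` at the first `p` positions. -/
def zerosBefore (x : List Bool) (p : ℕ) : ℕ :=
  ∑ j ∈ Finset.range p, if x[j]? = some true then 0 else 1

/-- The number with index `i` in the list of numbers that a bit string encodes: the number of ones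
that have exactly `i` zeros before them. It is `0` if there are at most `i` numbers. -/
def entry (x : List Bool) (i : ℕ) : ℕ :=
  ∑ p ∈ Finset.range x.length, if x[p]? = some true ∧ zerosBefore x p = i then 1 else 0

theorem entry_le_length (x : List Bool) (i : ℕ) : entry x i ≤ x.length := by
  unfold entry
  rw [Finset.sum_boole]
  simpa using Finset.card_filter_le (Finset.range x.length)
    fun p => x[p]? = some true ∧ zerosBefore x p = i

theorem zerosBefore_cons (b : Bool) (x : List Bool) (p : ℕ) :
    zerosBefore (b :: x) (p + 1) = zerosBefore x p + if b then 0 else 1 := by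
  simp [zerosBefore, Finset.sum_range_succ']

theorem entry_true (x : List Bool) (i : ℕ) :
    entry (true :: x) i = entry x i + if i = 0 then 1 else 0 := by
  rw [entry, List.length_cons, Finset.sum_range_succ']
  have h₀ : zerosBefore (true :: x) 0 = 0 := by simp [zerosBefore]
  simp [zerosBefore_cons, entry, h₀, @eq_comm _ 0 i]

theorem entry_false_zero (x : List Bool) : entry (false :: x) 0 = 0 := by
  rw [entry, List.length_cons, Finset.sum_range_succ']
  simp [zerosBefore_cons]

theorem entry_false_succ (x : List Bool) (i : ℕ) : entry (false :: x) (i + 1) = entry x i := by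
  rw [entry, List.length_cons, Finset.sum_range_succ']
  simp [zerosBefore_cons, entry]

theorem unaryCode_cons (m : ℕ) (l : List ℕ) :
    unaryCode (m :: l) = List.replicate m true ++ false :: unaryCode l := by
  simp [unaryCode]

theorem entry_unaryCode (l : List ℕ) (i : ℕ) : entry (unaryCode l) i = l.getD i 0 := by
  induction l generalizing i with
  | nil => simp [unaryCode, entry]
  | cons m l ih =>
    rw [unaryCode_cons]
    induction m with
    | zero =>
      cases i with
      | zero => simp [entry_false_zero]
      | succ i => simp [entry_false_succ, ih]
    | succ m ihm =>
      rw [List.replicate_succ, List.cons_append, entry_true, ihm]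
      cases i <;> simp

theorem zerosBefore_unaryCode (l : List ℕ) :
    zerosBefore (unaryCode l) (unaryCode l).length = l.length := by
  induction l with
  | nil => simp [unaryCode, zerosBefore]
  | cons m l ih =>
    rw [unaryCode_cons]
    induction m with
    | zero => simp [zerosBefore_cons, ih]
    | succ m ihm =>
      rw [List.replicate_succ, List.cons_append, List.length_cons, zerosBefore_cons, ihm]
      simp

/-- Every bit string that does not end with a one encodes a list of numbers. -/
theorem exists_eq_unaryCode (x : List Bool) (h : x[x.length - 1]? ≠ some true) :
    ∃ l, x = unaryCode l := by
  induction x with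
  | nil => exact ⟨[], rfl⟩
  | cons b x ih =>
    cases x with
    | nil =>
      cases b with
      | true => simp at h
      | false => exact ⟨[0], rfl⟩
    | cons c x =>
      obtain ⟨l, hl⟩ := ih (by simpa using h)
      cases b with
      | false => exact ⟨0 :: l, by rw [hl, unaryCode_cons]; rfl⟩
      | true =>
        cases l with
        | nil => simp [unaryCode] at hl
        | cons m l =>
          exact ⟨(m + 1) :: l, by rw [hl, unaryCode_cons, unaryCode_cons]; rfl⟩

theorem last_unaryCode (l : List ℕ) :
    (unaryCode l)[(unaryCode l).length - 1]? ≠ some true := by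
  induction l with
  | nil => simp [unaryCode]
  | cons m l ih =>
    rw [unaryCode_cons]
    induction m with
    | zero =>
      cases h : unaryCode l with
      | nil => simp
      | cons b y => rw [h] at ih; simpa using ih
    | succ m ihm =>
      rw [List.replicate_succ, List.cons_append]
      have : List.replicate m true ++ false :: unaryCode l ≠ [] := by simp
      obtain ⟨b, y, hy⟩ := List.exists_cons_of_ne_nil this
      rw [hy] at ihm ⊢
      simpa using ihm

end UnaryCode

/-! ### Tables as concatenated rows -/

section Tables

variable {β : Type} {n m : ℕ}

/-- The entry in row `q` and column `j` of a table with rows of length `m`. -/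
theorem getElem?_flatMap_finRange (f : Fin n → List β) (hf : ∀ q, (f q).length = m) (q : Fin n)
    {j : ℕ} (hj : j < m) : ((List.finRange n).flatMap f)[q * m + j]? = (f q)[j]? := by
  induction n with
  | zero => exact q.elim0
  | succ n ih =>
    rw [List.finRange_succ, List.flatMap_cons, List.flatMap_map]
    refine Fin.cases ?_ (fun q => ?_) q
    · rw [List.getElem?_append_left (by rw [hf]; simpa using hj)]
      simp
    · rw [List.getElem?_append_right (by rw [hf, Fin.val_succ, Nat.succ_mul]; omega), hf,
        ← ih (fun q => f q.succ) (fun q => hf _) q]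
      congr 1
      rw [Fin.val_succ, Nat.succ_mul]
      omega

theorem flatMap_finRange_eq (f : Fin n → List β) (hf : ∀ q, (f q).length = m) (L : List β)
    (hL : L.length = n * m) (h : ∀ (q : Fin n) (j : ℕ), j < m → L[q * m + j]? = (f q)[j]?) :
    (List.finRange n).flatMap f = L := by
  have hlen : ((List.finRange n).flatMap f).length = n * m := by
    simp [List.length_flatMap, hf]
  refine List.ext_getElem? fun k => ?_
  by_cases hk : k < n * m
  · have hm : 0 < m := Nat.pos_of_mul_pos_left (Nat.zero_lt_of_lt hk)
    have hq : k / m < n := (Nat.div_lt_iff_lt_mul hm).2 hk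
    have := getElem?_flatMap_finRange f hf ⟨k / m, hq⟩ (Nat.mod_lt k hm)
    rw [← h _ _ (Nat.mod_lt k hm)] at this
    simpa [Nat.div_add_mod'] using this
  · rw [List.getElem?_eq_none (by omega), List.getElem?_eq_none (by omega)]

end Tables

/-! ### Codes of automata -/

theorem mul_add_lt_mul {q n j m : ℕ} (hq : q < n) (hj : j < m) : q * m + j < n * m :=
  calc q * m + j < q * m + m := by omega
    _ = (q + 1) * m := (Nat.succ_mul q m).symm
    _ ≤ n * m := Nat.mul_le_mul_right m hq

namespace DVPDAInstance

variable (A : DVPDAInstance)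

theorem length_callTable : A.callTable.length = A.numStates * (A.numCall * 2) := by
  simp [callTable, List.length_flatMap]

theorem length_intTable : A.intTable.length = A.numStates * A.numInt := by
  simp [intTable, List.length_flatMap]

theorem length_retTable : A.retTable.length = A.numStates * (A.numRet * (A.numStack + 1)) := by
  simp [retTable, List.length_flatMap]

theorem getElem?_callTable (q : Fin A.numStates) (a : Fin A.numCall) {e : ℕ} (he : e < 2) :
    A.callTable[q * (A.numCall * 2) + (a * 2 + e)]?
      = [((A.aut.callTrans q a).1 : ℕ), ((A.aut.callTrans q a).2 : ℕ)][e]? := by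
  rw [callTable, getElem?_flatMap_finRange (m := A.numCall * 2) _
    (fun q => by simp [List.length_flatMap]) q (mul_add_lt_mul a.2 he),
    getElem?_flatMap_finRange (m := 2) _ (fun a => rfl) a he]

theorem getElem?_intTable (q : Fin A.numStates) (b : Fin A.numInt) :
    A.intTable[q * A.numInt + b]? = some (A.aut.intTrans q b : ℕ) := by
  rw [intTable, getElem?_flatMap_finRange (m := A.numInt) _ (fun q => by simp) q b.2]
  simp

theorem getElem?_retTable (q : Fin A.numStates) (d : Fin A.numRet) {γ : ℕ}
    (hγ : γ < A.numStack + 1) :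
    A.retTable[q * (A.numRet * (A.numStack + 1)) + (d * (A.numStack + 1) + γ)]?
      = ((A.aut.retTrans q d ⊥ : ℕ) ::
          (List.finRange A.numStack).map fun (γ : Fin A.numStack) =>
            (A.aut.retTrans q d (γ : WithBot (Fin A.numStack)) : ℕ))[γ]? := by
  rw [retTable, getElem?_flatMap_finRange (m := A.numRet * (A.numStack + 1)) _
    (fun q => by simp [List.length_flatMap]) q (mul_add_lt_mul d.2 hγ),
    getElem?_flatMap_finRange (m := A.numStack + 1) _ (fun d => by simp) d hγ]

end DVPDAInstance

/-- A bit string that is read as the sizes and the transition tables of an automaton. -/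
abbrev AutCode : Type := List Bool

namespace AutCode

open UnaryCode

variable (x : AutCode)

/-- The number of states. -/
def states : ℕ := entry x 0

/-- The number of call letters. -/
def calls : ℕ := entry x 1

/-- The number of internal letters. -/
def ints : ℕ := entry x 2

/-- The number of return letters. -/
def rets : ℕ := entry x 3

/-- The number of stack symbols other than the bottom symbol. -/
def symbols : ℕ := entry x 4

/-- The position of the table of the internal transitions, after the five sizes and the table of
the call transitions. -/
def intPos : ℕ := 5 + x.states * (x.calls * 2)

/-- The position of the table of the return transitions. -/
def retPos : ℕ := x.intPos + x.states * x.ints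

/-- The number of entries of a code of an automaton. -/
def size : ℕ := x.retPos + x.states * (x.rets * (x.symbols + 1))

/-- The next state on a call letter. -/
def callState (q a : ℕ) : ℕ := entry x (5 + (q * (x.calls * 2) + (a * 2 + 0)))

/-- The symbol that is pushed on a call letter. -/
def callSymbol (q a : ℕ) : ℕ := entry x (5 + (q * (x.calls * 2) + (a * 2 + 1)))

/-- The next state on an internal letter. -/
def intState (q b : ℕ) : ℕ := entry x (x.intPos + (q * x.ints + b))

/-- The next state on a return letter. The bottom symbol has the number `0` here, and the numbers
of all other symbols are moved up by one. -/
def retState (q d γ : ℕ) : ℕ :=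
  entry x (x.retPos + (q * (x.rets * (x.symbols + 1)) + (d * (x.symbols + 1) + γ)))

/-- The bit string is the code of an automaton: it encodes a list of numbers, which has the right
length, and all table entries are in range. -/
def Valid : Prop :=
  x[x.length - 1]? ≠ some true ∧ zerosBefore x x.length = x.size ∧
    (∀ q < x.states, ∀ a < x.calls, x.callState q a < x.states ∧ x.callSymbol q a < x.symbols) ∧
    (∀ q < x.states, ∀ b < x.ints, x.intState q b < x.states) ∧
    ∀ q < x.states, ∀ d < x.rets, ∀ γ < x.symbols + 1, x.retState q d γ < x.states

variable {x}

/-- The automaton with a given code. -/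
def toInstance (h : x.Valid) : DVPDAInstance where
  numStates := x.states
  numCall := x.calls
  numInt := x.ints
  numRet := x.rets
  numStack := x.symbols
  aut :=
    { callTrans := fun q a => (⟨x.callState q a, (h.2.2.1 q q.2 a a.2).1⟩,
        ⟨x.callSymbol q a, (h.2.2.1 q q.2 a a.2).2⟩)
      intTrans := fun q b => ⟨x.intState q b, h.2.2.2.1 q q.2 b b.2⟩
      retTrans := fun q d γ => match γ with
        | none => ⟨x.retState q d 0, h.2.2.2.2 q q.2 d d.2 0 (Nat.succ_pos _)⟩
        | some γ => ⟨x.retState q d (γ + 1), h.2.2.2.2 q q.2 d d.2 (γ + 1) (by omega)⟩ }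

theorem encode_toInstance (h : x.Valid) : (toInstance h).encode = x := by
  obtain ⟨l, hl⟩ := exists_eq_unaryCode x h.1
  have hlen : l.length = x.size := by rw [← zerosBefore_unaryCode, ← hl, h.2.1]
  have hent : ∀ i < x.size, l[i]? = some (entry x i) := by
    intro i hi
    rw [hl, entry_unaryCode, List.getD_eq_getElem _ _ (by omega), List.getElem?_eq_getElem]
  have hs : x.size = 5 + x.states * (x.calls * 2) + x.states * x.ints
    + x.states * (x.rets * (x.symbols + 1)) := rfl
  have hhead : [x.states, x.calls, x.ints, x.rets, x.symbols] = l.take 5 := by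
    refine List.ext_getElem? fun k => ?_
    rw [List.getElem?_take]
    split
    · next hk =>
      rw [hent k (by omega)]
      interval_cases k <;> rfl
    · next hk => exact List.getElem?_eq_none (by simp; omega)
  have hslice : ∀ p n k, k < n → p + n ≤ x.size →
      ((l.drop p).take n)[k]? = some (entry x (p + k)) := by
    intro p n k hk hp
    rw [List.getElem?_take_of_lt hk, List.getElem?_drop, hent _ (by omega)]
  have hc : (toInstance h).callTable = (l.drop 5).take (x.states * (x.calls * 2)) := by
    refine flatMap_finRange_eq (n := x.states) (m := x.calls * 2) _
      (fun q => by simp [List.length_flatMap]; rfl) _ (by simp; omega) fun q j hj => ?_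
    rw [hslice _ _ _ (mul_add_lt_mul q.2 hj) (by omega)]
    obtain ⟨a, ha, e, he, rfl⟩ : ∃ a < x.calls, ∃ e < 2, j = a * 2 + e :=
      ⟨j / 2, by omega, j % 2, by omega, by omega⟩
    refine Eq.trans ?_ (getElem?_flatMap_finRange (n := x.calls) (m := 2) _ (fun _ => rfl)
      ⟨a, ha⟩ he).symm
    interval_cases e <;> rfl
  have hi : (toInstance h).intTable = (l.drop x.intPos).take (x.states * x.ints) := by
    refine flatMap_finRange_eq (n := x.states) (m := x.ints) _
      (fun q => by simp; rfl) _ (by simp [intPos]; omega) fun q j hj => ?_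
    rw [hslice _ _ _ (mul_add_lt_mul q.2 hj) (by rw [intPos]; omega)]
    rw [List.getElem?_map, List.getElem?_eq_getElem (by rw [List.length_finRange]; exact hj)]
    simp [toInstance, intState]
  have hr : (toInstance h).retTable
      = (l.drop x.retPos).take (x.states * (x.rets * (x.symbols + 1))) := by
    refine flatMap_finRange_eq (n := x.states) (m := x.rets * (x.symbols + 1)) _
      (fun q => by simp [List.length_flatMap]; rfl) _ (by simp [retPos, intPos]; omega)
      fun q j hj => ?_
    rw [hslice _ _ _ (mul_add_lt_mul q.2 hj) (by rw [retPos, intPos]; omega)]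
    have hpos : 0 < x.symbols + 1 := Nat.succ_pos _
    obtain ⟨d, hd, γ, hγ, rfl⟩ : ∃ d < x.rets, ∃ γ < x.symbols + 1,
        j = d * (x.symbols + 1) + γ :=
      ⟨j / (x.symbols + 1), (Nat.div_lt_iff_lt_mul hpos).2 hj, j % (x.symbols + 1),
        Nat.mod_lt _ hpos, (Nat.div_add_mod' _ _).symm⟩
    refine Eq.trans ?_ (getElem?_flatMap_finRange (n := x.rets) (m := x.symbols + 1) _
      (fun _ => by simp; rfl) ⟨d, hd⟩ hγ).symm
    cases γ with
    | zero => rfl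
    | succ γ =>
      rw [List.getElem?_cons_succ, List.getElem?_map,
        List.getElem?_eq_getElem (by
          rw [List.length_finRange]; exact Nat.lt_of_succ_lt_succ hγ)]
      simp [toInstance, retState]
  have hl' : l = l.take 5 ++ (l.drop 5).take (x.states * (x.calls * 2))
      ++ (l.drop x.intPos).take (x.states * x.ints)
      ++ (l.drop x.retPos).take (x.states * (x.rets * (x.symbols + 1))) := by
    rw [← List.take_add, ← intPos, ← List.take_add, ← retPos, ← List.take_add, ← size, ← hlen,
      List.take_length]
  rw [DVPDAInstance.encode, hc, hi, hr]
  refine Eq.trans ?_ hl.symm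
  refine congrArg _ (Eq.trans ?_ hl'.symm)
  rw [← hhead]
  rfl

theorem valid_encode (A : DVPDAInstance) : Valid A.encode := by
  have hent : ∀ i, entry A.encode i = ([A.numStates, A.numCall, A.numInt, A.numRet, A.numStack] ++
    A.callTable ++ A.intTable ++ A.retTable).getD i 0 := fun i => entry_unaryCode _ i
  have h0 : states A.encode = A.numStates := hent 0
  have h1 : calls A.encode = A.numCall := hent 1
  have h2 : ints A.encode = A.numInt := hent 2
  have h3 : rets A.encode = A.numRet := hent 3
  have h4 : symbols A.encode = A.numStack := hent 4
  have hlc := A.length_callTable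
  have hli := A.length_intTable
  have hlr := A.length_retTable
  refine ⟨last_unaryCode _, ?_, ?_, ?_, ?_⟩
  · refine (zerosBefore_unaryCode _).trans ?_
    rw [size, retPos, intPos, h0, h1, h2, h3, h4]
    simp only [List.length_append, hlc, hli, hlr]
    rfl
  · intro q hq a ha
    rw [h0] at hq ⊢
    rw [h1] at ha
    have hcall : ∀ e < 2, entry A.encode (5 + (q * (calls A.encode * 2) + (a * 2 + e)))
        = [((A.aut.callTrans ⟨q, hq⟩ ⟨a, ha⟩).1 : ℕ),
          ((A.aut.callTrans ⟨q, hq⟩ ⟨a, ha⟩).2 : ℕ)].getD e 0 := by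
      intro e he
      have hlt := mul_add_lt_mul hq (mul_add_lt_mul ha he)
      have := A.getElem?_callTable ⟨q, hq⟩ ⟨a, ha⟩ he
      rw [hent, List.getD_eq_getElem?_getD, List.getD_eq_getElem?_getD, ← this, h1,
        List.append_assoc, List.append_assoc, List.getElem?_append_right (by simp),
        List.getElem?_append_left (by simp; omega)]
      simp
    rw [callState, callSymbol, hcall 0 two_pos, hcall 1 one_lt_two, h4]
    exact ⟨Fin.is_lt _, Fin.is_lt _⟩
  · intro q hq b hb
    rw [h0] at hq ⊢
    rw [h2] at hb
    have hlt := mul_add_lt_mul hq hb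
    have := A.getElem?_intTable ⟨q, hq⟩ ⟨b, hb⟩
    rw [intState, hent, List.getD_eq_getElem?_getD, intPos, h0, h1, h2,
      List.append_assoc, List.getElem?_append_right (by simp [hlc]; omega),
      List.getElem?_append_left (by simp [hlc]; omega)]
    simp only [List.length_append, hlc, List.length_cons, List.length_nil, Nat.zero_add,
      Nat.reduceAdd, Nat.add_sub_cancel_left]
    rw [this]
    exact Fin.is_lt _
  · intro q hq d hd γ hγ
    rw [h0] at hq ⊢
    rw [h3] at hd
    rw [h4] at hγ
    have hlt := mul_add_lt_mul hq (mul_add_lt_mul hd hγ)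
    have := A.getElem?_retTable ⟨q, hq⟩ ⟨d, hd⟩ hγ
    rw [retState, hent, List.getD_eq_getElem?_getD, retPos, intPos, h0, h1, h2, h3, h4,
      List.getElem?_append_right (by simp [hlc, hli]; omega)]
    simp only [List.length_append, hlc, hli, List.length_cons, List.length_nil, Nat.zero_add,
      Nat.reduceAdd, Nat.add_sub_cancel_left]
    rw [this]
    cases γ with
    | zero => exact Fin.is_lt _
    | succ γ =>
      have hγ' : γ < (List.finRange A.numStack).length := by simpa using hγ
      rw [List.getElem?_cons_succ, List.getElem?_map, List.getElem?_eq_getElem hγ']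
      exact Fin.is_lt _

/-- A property of the automaton encoded by a bit string can be expressed by its code. -/
theorem exists_eq_encode_iff {P : DVPDAInstance → Prop} :
    (∃ A, x = A.encode ∧ P A) ↔ ∃ h : x.Valid, P (toInstance h) := by
  constructor
  · rintro ⟨A, rfl, hA⟩
    have h := valid_encode A
    exact ⟨h, (congrArg P (DVPDAInstance.encode_injective (encode_toInstance h))).mpr hA⟩
  · rintro ⟨h, hP⟩
    exact ⟨toInstance h, (encode_toInstance h).symm, hP⟩

end AutCode

/-! ### Definability of the rules -/

section Definable

variable {σ : Type} {C : ExprContext σ} {f i : σ → ℕ}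

/-- A set of numbers that depends on the context is definable if membership is definable with the
number as a new variable. -/
def DefinableSet (C : ExprContext σ) (K : σ → Set ℕ) : Prop :=
  DefinablePred C.push fun p => p.2 ∈ K p.1

/-- The new variable is specified by a bounded quantifier, so that no substitution is needed. -/
theorem DefinableSet.mem {K : σ → Set ℕ} (hK : DefinableSet C K) (hf : Definable C f) :
    DefinablePred C fun s => f s ∈ K s := by
  refine (DefinablePred.exists_lt (R := fun s i => i = f s ∧ i ∈ K s) (hf.add (Definable.const 1))
    ((DefinablePred.eq Definable.last hf.weaken).and hK)).congr fun s => ?_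
  constructor
  · rintro ⟨_, _, rfl, h⟩
    exact h
  · exact fun h => ⟨f s, Nat.lt_succ_self _, rfl, h⟩

theorem DefinableSet.weaken {K : σ → Set ℕ} (hK : DefinableSet C K) :
    DefinableSet C.push fun p => K p.1 := by
  obtain ⟨e, he⟩ := hK
  refine ⟨e.rename (Expr.scons 0 fun j => j + 2), fun p => ?_⟩
  rw [Expr.eval_rename, ← he (p.1.1, p.2)]
  refine congrArg _ (funext fun j => ?_)
  cases j <;> rfl

/-- A list that depends on the context is readable if it has a definable length and is the final
part of the list of the context from a definable position on. -/
def Readable (C : ExprContext σ) (X : σ → List Bool) : Prop :=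
  Definable C (fun s => (X s).length) ∧
    ∃ off, Definable C off ∧ ∀ s p, (X s)[p]? = (C.list s)[off s + p]?

variable {X : σ → List Bool}

theorem Readable.weaken (hX : Readable C X) : Readable C.push fun p => X p.1 := by
  obtain ⟨h₁, off, h₂, h₃⟩ := hX
  exact ⟨h₁.weaken, fun p => off p.1, h₂.weaken, fun p => h₃ p.1⟩

theorem Readable.getElem? (hX : Readable C X) (hf : Definable C f) :
    DefinablePred C fun s => (X s)[f s]? = some true := by
  obtain ⟨_, off, h₂, h₃⟩ := hX
  exact (DefinablePred.read (h₂.add hf)).congr fun s => by rw [h₃]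

namespace UnaryCode

theorem definable_zerosBefore (hX : Readable C X) (hf : Definable C f) :
    Definable C fun s => zerosBefore (X s) (f s) :=
  (hf.sum (h := fun s j => if (X s)[j]? = some true then 0 else 1)
    (Definable.congr (Definable.ite (hX.weaken.getElem? Definable.last) (Definable.const 0)
      (Definable.const 1)) fun p => by congr)).congr fun s => rfl

theorem definable_entry (hX : Readable C X) (hf : Definable C f) :
    Definable C fun s => entry (X s) (f s) :=
  (hX.1.sum (h := fun s p => if (X s)[p]? = some true ∧ zerosBefore (X s) p = f s then 1 else 0)
    (Definable.congr ((hX.weaken.getElem? Definable.last).and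
      (DefinablePred.eq (definable_zerosBefore hX.weaken Definable.last) hf.weaken))
      fun p => by congr)).congr fun s => rfl

end UnaryCode

namespace AutCode

open UnaryCode

variable {q a d γ : σ → ℕ}

theorem definable_states (hX : Readable C X) : Definable C fun s => states (X s) :=
  definable_entry hX (Definable.const 0)

theorem definable_calls (hX : Readable C X) : Definable C fun s => calls (X s) :=
  definable_entry hX (Definable.const 1)

theorem definable_ints (hX : Readable C X) : Definable C fun s => ints (X s) :=
  definable_entry hX (Definable.const 2)

theorem definable_rets (hX : Readable C X) : Definable C fun s => rets (X s) :=
  definable_entry hX (Definable.const 3)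

theorem definable_symbols (hX : Readable C X) : Definable C fun s => symbols (X s) :=
  definable_entry hX (Definable.const 4)

theorem definable_intPos (hX : Readable C X) : Definable C fun s => intPos (X s) :=
  (Definable.const 5).add ((definable_states hX).mul ((definable_calls hX).mul (Definable.const 2)))

theorem definable_retPos (hX : Readable C X) : Definable C fun s => retPos (X s) :=
  (definable_intPos hX).add ((definable_states hX).mul (definable_ints hX))

theorem definable_size (hX : Readable C X) : Definable C fun s => size (X s) :=
  (definable_retPos hX).add ((definable_states hX).mul
    ((definable_rets hX).mul ((definable_symbols hX).add (Definable.const 1))))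

theorem definable_callState (hX : Readable C X) (hq : Definable C q) (ha : Definable C a) :
    Definable C fun s => callState (X s) (q s) (a s) :=
  definable_entry hX ((Definable.const 5).add
    ((hq.mul ((definable_calls hX).mul (Definable.const 2))).add
      ((ha.mul (Definable.const 2)).add (Definable.const 0))))

theorem definable_callSymbol (hX : Readable C X) (hq : Definable C q) (ha : Definable C a) :
    Definable C fun s => callSymbol (X s) (q s) (a s) :=
  definable_entry hX ((Definable.const 5).add
    ((hq.mul ((definable_calls hX).mul (Definable.const 2))).add
      ((ha.mul (Definable.const 2)).add (Definable.const 1))))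

theorem definable_intState (hX : Readable C X) (hq : Definable C q) (ha : Definable C a) :
    Definable C fun s => intState (X s) (q s) (a s) :=
  definable_entry hX ((definable_intPos hX).add ((hq.mul (definable_ints hX)).add ha))

theorem definable_retState (hX : Readable C X) (hq : Definable C q) (hd : Definable C d)
    (hγ : Definable C γ) : Definable C fun s => retState (X s) (q s) (d s) (γ s) :=
  have h := (definable_symbols hX).add (Definable.const 1)
  definable_entry hX ((definable_retPos hX).add ((hq.mul ((definable_rets hX).mul h)).add
    ((hd.mul h).add hγ)))

theorem definable_valid (hX : Readable C X) : DefinablePred C fun s => Valid (X s) := by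
  have hX₁ := hX.weaken
  have hX₂ := hX₁.weaken
  have hX₃ := hX₂.weaken
  refine (hX.getElem? (hX.1.sub (Definable.const 1))).not.and (.and
    (.eq (definable_zerosBefore hX hX.1) (definable_size hX)) (.and ?_ (.and ?_ ?_)))
  · exact .forall_lt (definable_states hX) (.forall_lt (definable_calls hX₁) (.and
      (.lt (definable_callState hX₂ Definable.last.weaken Definable.last) (definable_states hX₂))
      (.lt (definable_callSymbol hX₂ Definable.last.weaken Definable.last)
        (definable_symbols hX₂))))
  · exact .forall_lt (definable_states hX) (.forall_lt (definable_ints hX₁)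
      (.lt (definable_intState hX₂ Definable.last.weaken Definable.last) (definable_states hX₂)))
  · exact .forall_lt (definable_states hX) (.forall_lt (definable_rets hX₁)
      (.forall_lt ((definable_symbols hX₂).add (Definable.const 1))
        (.lt (definable_retState hX₃ Definable.last.weaken.weaken Definable.last.weaken
          Definable.last) (definable_states hX₃))))

end AutCode

end Definable

namespace AutCode

/-- The number of the fact that `DVPDA.Joint` holds for the given states. The number `k` is `1` for
words that are read with the empty stack, and `0` for well-matched words. -/
def factCode (n k p q p' q' : ℕ) : ℕ := (((k * n + p) * n + q) * n + p') * n + q'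

/-- The number of facts. -/
def numFacts (n : ℕ) : ℕ := 2 * n * n * n * n

theorem factCode_lt {n k p q p' q' : ℕ} (hk : k < 2) (hp : p < n) (hq : q < n) (hp' : p' < n)
    (hq' : q' < n) : factCode n k p q p' q' < numFacts n :=
  mul_add_lt_mul (mul_add_lt_mul (mul_add_lt_mul (mul_add_lt_mul hk hp) hq) hp') hq'

theorem mul_add_inj {n a b a' b' : ℕ} (hb : b < n) (hb' : b' < n) (h : a * n + b = a' * n + b') :
    a = a' ∧ b = b' := by
  have h₁ : (b + n * a) / n = (b' + n * a') / n := by rw [show b + n * a = b' + n * a' by lia]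
  have hn : 0 < n := by omega
  rw [Nat.add_mul_div_left _ _ hn, Nat.add_mul_div_left _ _ hn, Nat.div_eq_of_lt hb,
    Nat.div_eq_of_lt hb', Nat.zero_add, Nat.zero_add] at h₁
  subst h₁
  exact ⟨rfl, by omega⟩

theorem factCode_inj {n k p q p' q' l r s r' s' : ℕ} (hp : p < n) (hq : q < n) (hp' : p' < n)
    (hq' : q' < n) (hr : r < n) (hs : s < n) (hr' : r' < n) (hs' : s' < n)
    (h : factCode n k p q p' q' = factCode n l r s r' s') :
    k = l ∧ p = r ∧ q = s ∧ p' = r' ∧ q' = s' := by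
  obtain ⟨h, h₁⟩ := mul_add_inj hq' hs' h
  obtain ⟨h, h₂⟩ := mul_add_inj hp' hr' h
  obtain ⟨h, h₃⟩ := mul_add_inj hq hs h
  obtain ⟨h, h₄⟩ := mul_add_inj hp hr h
  exact ⟨h, h₄, h₃, h₂, h₁⟩

/-- The rule for internal letters. -/
def IntRule (x : AutCode) (p q p' q' : ℕ) : Prop :=
  ∃ b < x.ints, p' = x.intState p b ∧ q' = x.intState q b

/-- The rule for the composition of two words. -/
def TransRule (x : AutCode) (K : Set ℕ) (k p q p' q' : ℕ) : Prop :=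
  ∃ p₁ < x.states, ∃ q₁ < x.states,
    factCode x.states k p q p₁ q₁ ∈ K ∧ factCode x.states k p₁ q₁ p' q' ∈ K

/-- The rule for a well-matched word between a call letter and a return letter. -/
def NestRule (x : AutCode) (K : Set ℕ) (p q p' q' : ℕ) : Prop :=
  ∃ a < x.calls, ∃ d < x.rets, ∃ p₁ < x.states, ∃ q₁ < x.states,
    factCode x.states 0 (x.callState p a) (x.callState q a) p₁ q₁ ∈ K ∧
      p' = x.retState p₁ d (x.callSymbol p a + 1) ∧ q' = x.retState q₁ d (x.callSymbol q a + 1)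

/-- The rule for a return letter that is read with the empty stack. -/
def BotRule (x : AutCode) (p q p' q' : ℕ) : Prop :=
  ∃ d < x.rets, p' = x.retState p d 0 ∧ q' = x.retState q d 0

/-- The fact `f` follows from the facts in `K` by one of the rules that define `DVPDA.Joint`. -/
def Follows (x : AutCode) (K : Set ℕ) (f : ℕ) : Prop :=
  ∃ k < 2, ∃ p < x.states, ∃ q < x.states, ∃ p' < x.states, ∃ q' < x.states,
    f = factCode x.states k p q p' q' ∧
      ((p = p' ∧ q = q') ∨ IntRule x p q p' q' ∨ TransRule x K k p q p' q' ∨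
        NestRule x K p q p' q' ∨ (k = 1 ∧ BotRule x p q p' q'))

/-- There is a state, and every two states can be merged according to the facts in `K`. -/
def AllMerge (x : AutCode) (K : Set ℕ) : Prop :=
  0 < x.states ∧ ∀ p < x.states, ∀ q < x.states, ∃ r < x.states, factCode x.states 1 p q r r ∈ K

theorem Follows.mono {x : AutCode} ⦃K K' : Set ℕ⦄ ⦃f : ℕ⦄ (hK : K ⊆ K') (h : Follows x K f) :
    Follows x K' f := by
  obtain ⟨k, hk, p, hp, q, hq, p', hp', q', hq', e, h⟩ := h
  refine ⟨k, hk, p, hp, q, hq, p', hp', q', hq', e, ?_⟩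
  rcases h with h | h | ⟨p₁, hp₁, q₁, hq₁, h₁, h₂⟩ | h | h
  · exact .inl h
  · exact .inr (.inl h)
  · exact .inr (.inr (.inl ⟨p₁, hp₁, q₁, hq₁, hK h₁, hK h₂⟩))
  · obtain ⟨a, ha, d, hd, p₁, hp₁, q₁, hq₁, h₁, h₂⟩ := h
    exact .inr (.inr (.inr (.inl ⟨a, ha, d, hd, p₁, hp₁, q₁, hq₁, hK h₁, h₂⟩)))
  · exact .inr (.inr (.inr (.inr h)))

section Definable

variable {σ : Type} {C : ExprContext σ} {X : σ → List Bool} {K : σ → Set ℕ}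
  {n k p q p' q' : σ → ℕ}

theorem definable_factCode (hn : Definable C n) (hk : Definable C k) (hp : Definable C p)
    (hq : Definable C q) (hp' : Definable C p') (hq' : Definable C q') :
    Definable C fun s => factCode (n s) (k s) (p s) (q s) (p' s) (q' s) :=
  ((((((hk.mul hn).add hp).mul hn).add hq).mul hn).add hp' |>.mul hn).add hq'

theorem definable_intRule (hX : Readable C X) (hp : Definable C p) (hq : Definable C q)
    (hp' : Definable C p') (hq' : Definable C q') :
    DefinablePred C fun s => IntRule (X s) (p s) (q s) (p' s) (q' s) :=
  .exists_lt (definable_ints hX)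
    (.and (.eq hp'.weaken (definable_intState hX.weaken hp.weaken Definable.last))
      (.eq hq'.weaken (definable_intState hX.weaken hq.weaken Definable.last)))

theorem definable_transRule (hX : Readable C X) (hK : DefinableSet C K) (hk : Definable C k)
    (hp : Definable C p) (hq : Definable C q) (hp' : Definable C p') (hq' : Definable C q') :
    DefinablePred C fun s => TransRule (X s) (K s) (k s) (p s) (q s) (p' s) (q' s) := by
  have hn := (definable_states hX).weaken.weaken
  have hK₂ := hK.weaken.weaken
  exact .exists_lt (definable_states hX) (.exists_lt (definable_states hX.weaken) (.and
    (hK₂.mem (definable_factCode hn hk.weaken.weaken hp.weaken.weaken hq.weaken.weaken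
      Definable.last.weaken Definable.last))
    (hK₂.mem (definable_factCode hn hk.weaken.weaken Definable.last.weaken Definable.last
      hp'.weaken.weaken hq'.weaken.weaken))))

theorem definable_nestRule (hX : Readable C X) (hK : DefinableSet C K)
    (hp : Definable C p) (hq : Definable C q) (hp' : Definable C p') (hq' : Definable C q') :
    DefinablePred C fun s => NestRule (X s) (K s) (p s) (q s) (p' s) (q' s) := by
  have hX₁ := hX.weaken
  have hX₂ := hX₁.weaken
  have hX₃ := hX₂.weaken
  have hX₄ := hX₃.weaken
  have hp₄ := hp.weaken.weaken.weaken.weaken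
  have hq₄ := hq.weaken.weaken.weaken.weaken
  have ha := (Definable.last (C := C)).weaken.weaken.weaken
  have hd := (Definable.last (C := C.push)).weaken.weaken
  have hp₁ := (Definable.last (C := C.push.push)).weaken
  have hq₁ := Definable.last (C := C.push.push.push)
  have hsym := fun {r} (hr : Definable C.push.push.push.push r) =>
    (definable_callSymbol hX₄ hr ha).add (Definable.const 1)
  exact .exists_lt (definable_calls hX) (.exists_lt (definable_rets hX₁)
    (.exists_lt (definable_states hX₂) (.exists_lt (definable_states hX₃) (.and
      (hK.weaken.weaken.weaken.weaken.mem (definable_factCode (definable_states hX₄)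
        (Definable.const 0) (definable_callState hX₄ hp₄ ha) (definable_callState hX₄ hq₄ ha)
        hp₁ hq₁))
      (.and
        (.eq hp'.weaken.weaken.weaken.weaken (definable_retState hX₄ hp₁ hd (hsym hp₄)))
        (.eq hq'.weaken.weaken.weaken.weaken (definable_retState hX₄ hq₁ hd (hsym hq₄))))))))

theorem definable_botRule (hX : Readable C X) (hp : Definable C p) (hq : Definable C q)
    (hp' : Definable C p') (hq' : Definable C q') :
    DefinablePred C fun s => BotRule (X s) (p s) (q s) (p' s) (q' s) :=
  .exists_lt (definable_rets hX)
    (.and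
      (.eq hp'.weaken (definable_retState hX.weaken hp.weaken Definable.last (Definable.const 0)))
      (.eq hq'.weaken (definable_retState hX.weaken hq.weaken Definable.last (Definable.const 0))))

theorem definable_follows {f : σ → ℕ} (hX : Readable C X) (hK : DefinableSet C K)
    (hf : Definable C f) : DefinablePred C fun s => Follows (X s) (K s) (f s) := by
  have hX₁ := hX.weaken
  have hX₂ := hX₁.weaken
  have hX₃ := hX₂.weaken
  have hX₄ := hX₃.weaken
  have hX₅ := hX₄.weaken
  have hK₅ := hK.weaken.weaken.weaken.weaken.weaken
  have hk := (Definable.last (C := C)).weaken.weaken.weaken.weaken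
  have hp := (Definable.last (C := C.push)).weaken.weaken.weaken
  have hq := (Definable.last (C := C.push.push)).weaken.weaken
  have hp' := (Definable.last (C := C.push.push.push)).weaken
  have hq' := Definable.last (C := C.push.push.push.push)
  exact .exists_lt (Definable.const 2) (.exists_lt (definable_states hX₁)
    (.exists_lt (definable_states hX₂) (.exists_lt (definable_states hX₃)
      (.exists_lt (definable_states hX₄) (.and
        (.eq hf.weaken.weaken.weaken.weaken.weaken
          (definable_factCode (definable_states hX₅) hk hp hq hp' hq'))
        (.or (.and (.eq hp hp') (.eq hq hq')) (.or (definable_intRule hX₅ hp hq hp' hq')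
          (.or (definable_transRule hX₅ hK₅ hk hp hq hp' hq')
            (.or (definable_nestRule hX₅ hK₅ hp hq hp' hq')
              (.and (.eq hk (Definable.const 1))
                (definable_botRule hX₅ hp hq hp' hq')))))))))))

theorem definable_allMerge (hX : Readable C X) (hK : DefinableSet C K) :
    DefinablePred C fun s => AllMerge (X s) (K s) := by
  have hp := (Definable.last (C := C)).weaken.weaken
  have hq := (Definable.last (C := C.push)).weaken
  have hr := Definable.last (C := C.push.push)
  have hn := definable_states hX
  exact .and (.lt (Definable.const 0) hn) (.forall_lt hn (.forall_lt hn.weaken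
    (.exists_lt hn.weaken.weaken (hK.weaken.weaken.weaken.mem
      (definable_factCode hn.weaken.weaken.weaken (Definable.const 1) hp hq hr hr)))))

end Definable

end AutCode

/-! ### The facts that hold for an automaton -/

namespace AutCode

variable {x : AutCode}

/-- The numbers of the facts that hold for the automaton with the code `x`. -/
def trueFacts (h : x.Valid) : Set ℕ :=
  {f | ∃ (k : Bool) (p q p' q' : Fin x.states), f = factCode x.states k.toNat p q p' q' ∧
    (toInstance h).aut.Joint k p q p' q'}

theorem mem_trueFacts (h : x.Valid) (k : Bool) (p q p' q' : Fin x.states) :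
    factCode x.states k.toNat p q p' q' ∈ trueFacts h ↔
      (toInstance h).aut.Joint k p q p' q' := by
  constructor
  · rintro ⟨l, r, s, r', s', e, hJ⟩
    obtain ⟨h₀, h₁, h₂, h₃, h₄⟩ := factCode_inj p.2 q.2 p'.2 q'.2 r.2 s.2 r'.2 s'.2 e
    have h₀ : k = l := by revert h₀; cases k <;> cases l <;> simp
    rw [h₀, Fin.ext h₁, Fin.ext h₂, Fin.ext h₃, Fin.ext h₄]
    exact hJ
  · exact fun hJ => ⟨k, p, q, p', q', rfl, hJ⟩

theorem trueFacts_closed (h : x.Valid) {f : ℕ} (hf : Follows x (trueFacts h) f) :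
    f ∈ trueFacts h := by
  obtain ⟨k, hk, p, hp, q, hq, p', hp', q', hq', rfl, hR⟩ := hf
  obtain ⟨k, rfl⟩ : ∃ b : Bool, k = b.toNat := by
    interval_cases k
    · exact ⟨false, rfl⟩
    · exact ⟨true, rfl⟩
  refine (mem_trueFacts h k ⟨p, hp⟩ ⟨q, hq⟩ ⟨p', hp'⟩ ⟨q', hq'⟩).2 ?_
  rcases hR with ⟨rfl, rfl⟩ | ⟨b, hb, rfl, rfl⟩ | ⟨p₁, hp₁, q₁, hq₁, h₁, h₂⟩ |
    ⟨a, ha, d, hd, p₁, hp₁, q₁, hq₁, h₁, rfl, rfl⟩ | ⟨hk', d, hd, rfl, rfl⟩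
  · exact .refl _ _ _
  · exact .int (M := (toInstance h).aut) k ⟨p, hp⟩ ⟨q, hq⟩ ⟨b, hb⟩
  · exact .trans ((mem_trueFacts h k ⟨p, hp⟩ ⟨q, hq⟩ ⟨p₁, hp₁⟩ ⟨q₁, hq₁⟩).1 h₁)
      ((mem_trueFacts h k ⟨p₁, hp₁⟩ ⟨q₁, hq₁⟩ ⟨p', hp'⟩ ⟨q', hq'⟩).1 h₂)
  · exact .nest (M := (toInstance h).aut) k ⟨p, hp⟩ ⟨q, hq⟩ ⟨a, ha⟩ ⟨d, hd⟩
      ((mem_trueFacts h false _ _ ⟨p₁, hp₁⟩ ⟨q₁, hq₁⟩).1 h₁)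
  · obtain rfl : k = true := by cases k <;> simp_all
    exact .bot (M := (toInstance h).aut) ⟨p, hp⟩ ⟨q, hq⟩ ⟨d, hd⟩

/-- A set of facts that is closed under the rules contains all facts that hold. -/
theorem trueFacts_subset (h : x.Valid) {K : Set ℕ}
    (hK : ∀ f < numFacts x.states, Follows x K f → f ∈ K) : trueFacts h ⊆ K := by
  rintro _ ⟨k, p, q, p', q', rfl, hJ⟩
  have close : ∀ (k : Bool) (p q p' q' : Fin x.states),
      ((p.1 = p' ∧ q.1 = q') ∨ IntRule x p q p' q' ∨ TransRule x K k.toNat p q p' q' ∨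
        NestRule x K p q p' q' ∨ (k.toNat = 1 ∧ BotRule x p q p' q')) →
      factCode x.states k.toNat p q p' q' ∈ K := fun k p q p' q' hR =>
    hK _ (factCode_lt k.toNat_lt p.2 q.2 p'.2 q'.2) ⟨_, k.toNat_lt, p, p.2, q, q.2, p', p'.2,
      q', q'.2, rfl, hR⟩
  induction hJ with
  | refl k p q => exact close k p q p q (.inl ⟨rfl, rfl⟩)
  | int k p q b =>
    exact close k p q _ _ (.inr (.inl ⟨b, b.2, rfl, rfl⟩))
  | @trans k p q p₁ q₁ p₂ q₂ _ _ ih₁ ih₂ =>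
    exact close k p q p₂ q₂ (.inr (.inr (.inl ⟨p₁, p₁.2, q₁, q₁.2, ih₁, ih₂⟩)))
  | @nest k p q a d p₁ q₁ _ ih =>
    exact close k p q _ _
      (.inr (.inr (.inr (.inl ⟨a, a.2, d, d.2, p₁, p₁.2, q₁, q₁.2, ih, rfl, rfl⟩))))
  | bot p q d =>
    exact close true p q _ _ (.inr (.inr (.inr (.inr ⟨rfl, d, d.2, rfl, rfl⟩))))

theorem exists_synchronizesEmpty_iff_allMerge (h : x.Valid) :
    (∃ w, (toInstance h).aut.SynchronizesEmpty w) ↔ AllMerge x (trueFacts h) := by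
  rw [DVPDA.exists_synchronizesEmpty_iff]
  refine and_congr Fin.pos_iff_nonempty.symm ?_
  constructor
  · intro hJ p hp q hq
    obtain ⟨r, hr⟩ := hJ ⟨p, hp⟩ ⟨q, hq⟩
    exact ⟨r, r.2, (mem_trueFacts h true ⟨p, hp⟩ ⟨q, hq⟩ r r).2 hr⟩
  · intro hK p q
    obtain ⟨r, hr, hf⟩ := hK p p.2 q q.2
    exact ⟨⟨r, hr⟩, (mem_trueFacts h true p q ⟨r, hr⟩ ⟨r, hr⟩).1 hf⟩

end AutCode

/-! ### The fixed point computation as an iteration -/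

namespace Expr

/-- The truth value that the iteration of `e` on the input `x` finds at time `i`. -/
def Holds (e : Expr) (x : List Bool) (i : ℕ) : Prop :=
  e.eval ((e.extend x.length)^[i] x) (fun _ => x.length) ≠ 0

theorem getElem?_iterate_extend (e : Expr) (x : List Bool) {i t : ℕ} (hi : i < t) :
    ((e.extend x.length)^[t] x)[t - 1 - i]? = some true ↔ e.Holds x i := by
  induction t with
  | zero => omega
  | succ t ih =>
    rw [Function.iterate_succ_apply', extend]
    rcases Nat.lt_succ_iff_lt_or_eq.1 hi with hi | rfl
    · rw [← ih hi, show t + 1 - 1 - i = (t - 1 - i) + 1 by omega, List.getElem?_cons_succ]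
    · simp [Holds]

theorem getElem?_iterate_extend_add (e : Expr) (x : List Bool) (t p : ℕ) :
    ((e.extend x.length)^[t] x)[t + p]? = x[p]? := by
  induction t with
  | zero => simp
  | succ t ih =>
    rw [Function.iterate_succ_apply', extend, show t + 1 + p = (t + p) + 1 by omega,
      List.getElem?_cons_succ, ih]

end Expr

/-- The context in which the rounds of an iteration are evaluated: the list is followed by the
length of the input, which is the value of all variables. -/
def roundContext : ExprContext (List Bool × ℕ) where
  list s := s.1
  var _ s := s.2

namespace AutCode

/-- The number of rounds that have passed. During an iteration the list is not shorter than the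
input, so that the subtraction is exact. -/
def time (s : List Bool × ℕ) : ℕ := s.1.length - s.2

/-- The input of the iteration, which is the final part of the list. -/
def input (s : List Bool × ℕ) : AutCode := s.1.drop (time s)

/-- The time at which all facts have been found. -/
def deadline (s : List Bool × ℕ) : ℕ :=
  numFacts (input s).states * (numFacts (input s).states + 1)

/-- The facts that have been found. The bound on `i` is the minimum of the time and the deadline, as
later truth values do not stand for facts. The list starts with the latest truth value. -/
def found (s : List Bool × ℕ) : Set ℕ :=
  {f | ∃ i < time s - (time s - deadline s), i % numFacts (input s).states = f ∧
    s.1[time s - 1 - i]? = some true}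

/-- The truth value to be computed in one round: up to the deadline, whether the fact whose turn it
is follows from the facts found before, and after the deadline, whether the input is to be
accepted. -/
def Round (E : AutCode → Prop) (s : List Bool × ℕ) : Prop :=
  (time s < deadline s ∧ Follows (input s) (found s) (time s % numFacts (input s).states)) ∨
    (deadline s ≤ time s ∧ Valid (input s) ∧ E (input s) ∧ AllMerge (input s) (found s))

theorem definable_round (E : AutCode → Prop)
    (hE : ∀ {σ : Type} {C : ExprContext σ} {X : σ → List Bool}, Readable C X →
      DefinablePred C fun s => E (X s)) : DefinablePred roundContext (Round E) := by
  have hN : Definable roundContext fun s => s.2 := Definable.var 0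
  have ht : Definable roundContext time := Definable.length.sub hN
  have hX : Readable roundContext input := by
    refine ⟨(Definable.length.sub ht).congr fun s => by simp [input, roundContext], time, ht,
      fun s p => ?_⟩
    simp [input, roundContext]
  have hn := definable_states hX
  have hM : Definable roundContext fun s => numFacts (input s).states :=
    ((((Definable.const 2).mul hn).mul hn).mul hn).mul hn
  have hT : Definable roundContext deadline := hM.mul (hM.add (Definable.const 1))
  have hK : DefinableSet roundContext found := by
    have ht₁ := ht.weaken
    have ht₂ := ht₁.weaken
    exact .exists_lt (ht₁.sub (ht₁.sub hT.weaken)) (.and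
      (.eq (Definable.last.mod hM.weaken.weaken) Definable.last.weaken)
      (.read ((ht₂.sub (Definable.const 1)).sub Definable.last)))
  exact .or (.and (.lt ht hT) (definable_follows hX hK (ht.mod hM)))
    (.and (.le hT ht) (.and (definable_valid hX) (.and (hE hX) (definable_allMerge hX hK))))

/-- A property of automata that can be read off from the code by an expression can be decided in
polynomial time together with the existence of a synchronizing word. -/
theorem decidableInPolyTime_sync (E : AutCode → Prop) (P : DVPDAInstance → Prop)
    (hE : ∀ {σ : Type} {C : ExprContext σ} {X : σ → List Bool}, Readable C X →
      DefinablePred C fun s => E (X s))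
    (hP : ∀ (x : AutCode) (h : x.Valid), E x ↔ P (toInstance h)) :
    DecidableInPolyTime
      {x | ∃ A : DVPDAInstance, x = A.encode ∧ P A ∧ ∃ w, A.aut.SynchronizesEmpty w} := by
  classical
  obtain ⟨e, he⟩ := definable_round E hE
  have hN : Definable roundContext fun s => s.2 := Definable.var 0
  have hM : Definable roundContext fun s => numFacts s.2 :=
    ((((Definable.const 2).mul hN).mul hN).mul hN).mul hN
  obtain ⟨b, hb⟩ := (hM.mul (hM.add (Definable.const 1))).add (Definable.const 1)
  -- the length of the input is an upper bound for the number of states; after the rounds for the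
  -- facts there is one more for the final test
  refine Expr.decidableInPolyTime e b fun x => ?_
  have hb' : b.eval x (fun _ => x.length) = numFacts x.length * (numFacts x.length + 1) + 1 :=
    hb (x, x.length)
  rw [hb', Function.iterate_succ_apply', Expr.extend, List.head?_cons, Option.some_inj,
    decide_eq_true_iff]
  set n := states x with hn
  set T := numFacts n * (numFacts n + 1) with hT
  have hround : ∀ t, e.Holds x t ↔ Round E ((e.extend x.length)^[t] x, x.length) := by
    intro t
    have h := he ((e.extend x.length)^[t] x, x.length)
    simp only [roundContext] at h
    rw [Expr.Holds, h]
    simp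
  have htime : ∀ t, time ((e.extend x.length)^[t] x, x.length) = t := by
    intro t
    rw [time, Expr.length_iterate_extend]
    simp
  have hinput : ∀ t, input ((e.extend x.length)^[t] x, x.length) = x := by
    intro t
    rw [input, htime]
    refine List.ext_getElem? fun p => ?_
    rw [List.getElem?_drop, Expr.getElem?_iterate_extend_add]
  have hdead : ∀ t, deadline ((e.extend x.length)^[t] x, x.length) = T := by
    intro t
    rw [deadline, hinput]
  have hfound : ∀ t, found ((e.extend x.length)^[t] x, x.length)
      = {f | ∃ i < t - (t - T), i % numFacts n = f ∧ e.Holds x i} := by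
    intro t
    ext f
    rw [found, htime, hdead, hinput]
    refine exists_congr fun i => and_congr_right fun hi => and_congr_right fun _ => ?_
    exact Expr.getElem?_iterate_extend e x (by omega)
  have hrule : ∀ t < T, e.Holds x t ↔
      Follows x {f | ∃ i < t, i % numFacts n = f ∧ e.Holds x i} (t % numFacts n) := by
    intro t ht
    rw [hround, Round, htime, hdead, hinput, hfound, show t - (t - T) = t by omega]
    simp only [ht, true_and, not_le.2 ht, false_and, or_false]
    exact Iff.rfl
  obtain ⟨hclosed, hleast⟩ := recorded_closed_and_least (numFacts n) (Follows x)
    Follows.mono (e.Holds x) hrule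
  have hle : T ≤ numFacts x.length * (numFacts x.length + 1) := by
    have : n ≤ x.length := UnaryCode.entry_le_length x 0
    have : numFacts n ≤ numFacts x.length := by unfold numFacts; gcongr
    rw [hT]
    gcongr
  refine (hround (numFacts x.length * (numFacts x.length + 1))).trans ?_
  rw [Round, htime, hdead, hinput, hfound, Nat.sub_sub_self hle]
  simp only [not_lt.2 hle, false_and, false_or, hle, true_and]
  refine Iff.trans ?_ exists_eq_encode_iff.symm
  constructor
  · rintro ⟨hV, hEx, hA⟩
    refine ⟨hV, (hP x hV).1 hEx, (exists_synchronizesEmpty_iff_allMerge hV).2 ?_⟩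
    have hsub := hleast (trueFacts hV) fun f hf => trueFacts_closed hV hf
    exact ⟨hA.1, fun p hp q hq => (hA.2 p hp q hq).imp fun r hr => ⟨hr.1, hsub hr.2⟩⟩
  · rintro ⟨hV, hPx, hS⟩
    have hA := (exists_synchronizesEmpty_iff_allMerge hV).1 hS
    have hsub := trueFacts_subset hV hclosed
    exact ⟨hV, (hP x hV).2 hPx,
      hA.1, fun p hp q hq => (hA.2 p hp q hq).imp fun r hr => ⟨hr.1, hsub hr.2⟩⟩

/-- All call transitions with the same letter push the same symbol. -/
def SameSymbols (x : AutCode) : Prop :=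
  ∀ a < x.calls, ∀ p < x.states, ∀ q < x.states, x.callSymbol p a = x.callSymbol q a

theorem definable_sameSymbols {σ : Type} {C : ExprContext σ} {X : σ → List Bool}
    (hX : Readable C X) : DefinablePred C fun s => SameSymbols (X s) := by
  have hX₃ := hX.weaken.weaken.weaken
  have ha := (Definable.last (C := C)).weaken.weaken
  exact .forall_lt (definable_calls hX) (.forall_lt (definable_states hX.weaken)
    (.forall_lt (definable_states hX.weaken.weaken)
      (.eq (definable_callSymbol hX₃ Definable.last.weaken ha)
        (definable_callSymbol hX₃ Definable.last ha))))

end AutCode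

open AutCode in
theorem mainTheorem1 :
    DecidableInPolyTime SyncDVPDAEmpty ∧
      DecidableInPolyTime SyncDVCAEmpty ∧
      DecidableInPolyTime SyncDVVPDAEmpty := by
  refine ⟨?_, ?_, ?_⟩
  · have h := decidableInPolyTime_sync (fun _ => True) (fun _ => True)
      (fun _ => (DefinablePred.eq (Definable.const 0) (Definable.const 0)).congr fun _ => by simp)
      (fun _ _ => Iff.rfl)
    simp only [true_and] at h
    exact h
  · exact decidableInPolyTime_sync (fun x => x.symbols = 1) (fun A => A.aut.IsCounter)
      (fun hX => .eq (definable_symbols hX) (Definable.const 1))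
      (fun x h => by rw [DVPDA.IsCounter, Nat.card_fin]; rfl)
  · refine decidableInPolyTime_sync SameSymbols (fun A => A.aut.IsVeryVisibly)
      definable_sameSymbols fun x h => ?_
    constructor
    · exact fun hS a p q => Fin.ext (hS a a.2 p p.2 q q.2)
    · exact fun hS a ha p hp q hq => congrArg Fin.val (hS ⟨a, ha⟩ ⟨p, hp⟩ ⟨q, hq⟩)
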